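/- Let $\mathcal G=(G_1,G_2,\dots)$ be a sequence of groups, each with a fixed finite tuple of generators $X_i=(x_{i,1},\dots,x_{i,n_i})$ (trivial groups with $n_i=0$ are allowed, so finite families are included). Let $G=\bigoplus_i G_i$, and let $x_1,x_2,\dots$ be the concatenation of $X_1,X_2,\dots$, regarded as a list of generators of $G$. Let $\langle t\rangle$ and $\langle s\rangle$ be infinite cyclic, and let $G\wr\langle t\rangle\wr\langle s\rangle$ be the unrestricted double wreath product, where for functions $f$ on a cyclic group $Q$ and $q\in Q$ one has $(qfq^{-1})(p)=f(pq)$. Let $f_m\in G^{\langle t\rangle}$ take the value $x_m$ at $t^k$ for $k>0$ and $1$ elsewhere, and let $F\in (G\wr\langle t\rangle)^{\langle s\rangle}$ satisfy $F(s)=t$, $F(s^{2^m})=f_m$ for every $m\ge 1$ for which $x_m$ exists, and $F(s^k)=1$ for all other $k$. Let $\widetilde H=\langle s,F\rangle\le G\wr\langle t\rangle\wr\langle s\rangle$. Then the assignment $x_m\mapsto [F,\,s^{2^m-1}Fs^{-(2^m-1)}]$, with $[a,b]=aba^{-1}b^{-1}$, extends to an embedding $\Psi:G\hookrightarrow\widetilde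 H$, and the following hold. Words in $\widetilde H$ are words in $s^{\pm1},F^{\pm1}$. 1. Suppose that $\mathcal G$ is recursively enumerated, that is, there is a computable map $i\mapsto\mathcal{TM}_i$ such that the machine $\mathcal{TM}_i$ outputs the number $n_i$ of generators and lists the relators of a presentation of $G_i$ on $X_i$. Then the induced embedding $G_i\hookrightarrow\widetilde H$ is computable for every $i$: an algorithm outputs for each $j\le n_i$ a word that represents $\Psi(x_{i,j})$; moreover, one algorithm does this for all $i$ and $j$. 2. Suppose that the machines $\mathcal{TM}_i$ in (1) can be chosen so that, in addition, $\mathcal{TM}_i$ solves the word problem of $G_i$ with respect to $X_i$. Then $\widetilde H$ has decidable word problem, and for every $i$ the membership problem for $\Psi(G_i)$ in $\widetilde H$ is decidable. 3. Suppose that the machines $\mathcal{TM}_i$ in (1) can be chosen so that, in addition, $\mathcal{TM}_i$ enumerates, by words in $X_i^{\pm1}$, the positive cone of some computable left-order of $G_i$. Then $\widetilde H$ has a computable left-order. Here a left-order on a group with enumerated generators is computable if there is an algorithm that decides, for each word in the generators and their inverses, whether the element it represents is larger than, smaller than, or equal to the identity. -/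

import Mathlib

universe u v w

namespace WreathFamily

/-! ### Words, and algorithmic notions for groups with enumerated generators -/

/-- The element represented by a word in the letters `y b` and their inverses;
`(b, true)` stands for `y b` and `(b, false)` for its inverse. -/
def wordEval {β : Type v} {H : Type w} [Group H] (y : β → H) (l : List (β × Bool)) : H :=
  (l.map fun p => cond p.2 (y p.1) (y p.1)⁻¹).prod

/-- A map `φ` between groups with enumerated generators `x` and `y` is computable: an algorithm
outputs, for each index `a`, a word in the letters `y` that represents the image of `x a`. -/
def IsComputableMap {α β : Type} [Primcodable α] [Primcodable β] {K : Type v} {H : Type w}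
    [Group K] [Group H] (x : α → K) (y : β → H) (φ : K → H) : Prop :=
  ∃ f : α → List (β × Bool), Computable f ∧ ∀ a, wordEval y (f a) = φ (x a)

/-- Decidability of the word problem with respect to the generators `y`. -/
def HasDecidableWordProblem {β : Type} [Primcodable β] {H : Type w} [Group H]
    (y : β → H) : Prop :=
  ComputablePred fun l : List (β × Bool) => wordEval y l = 1

/-- Decidability of the membership problem for the subgroup `S`, with respect to `y`. -/
def HasDecidableMembership {β : Type} [Primcodable β] {H : Type w} [Group H]
    (y : β → H) (S : Subgroup H) : Prop :=
  ComputablePred fun l : List (β × Bool) => wordEval y l ∈ S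

/-- `r` is (the strict part of) a left-order: a strict total order that is invariant under left
multiplication. -/
structure IsLeftOrder {H : Type w} [Group H] (r : H → H → Prop) : Prop where
  irrefl : ∀ a, ¬ r a a
  trans : ∀ a b c, r a b → r b c → r a c
  total : ∀ a b, r a b ∨ a = b ∨ r b a
  mul_left : ∀ a b c, r a b → r (c * a) (c * b)

/-- `r` is a computable left-order with respect to the generators `y`: it can be decided whether
the element represented by a given word is larger than, smaller than, or equal to `1`. -/
structure IsComputableLeftOrder {β : Type} [Primcodable β] {H : Type w} [Group H]
    (y : β → H) (r : H → H → Prop) : Prop where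
  isLeftOrder : IsLeftOrder r
  larger : ComputablePred fun l : List (β × Bool) => r 1 (wordEval y l)
  smaller : ComputablePred fun l : List (β × Bool) => r (wordEval y l) 1
  equal : ComputablePred fun l : List (β × Bool) => wordEval y l = 1

/-! ### Recursively enumerated families

Machines are Gödel codes of partial recursive functions. A machine attached to a group performs
several tasks; the first component of its (paired) input is the number of the task. -/

/-- The word `l` is in the list that the machine `c` produces in the given task, that is, it is
the output for some input `k`. The list may be finite or empty, since `c` need not halt. -/
def Lists (c : Nat.Partrec.Code) (task : ℕ) {m : ℕ} (l : List (Fin m × Bool)) : Prop :=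
  ∃ k : ℕ, Encodable.encode l ∈ c.eval (Nat.pair task k)

/-- The machine `c` lists the generators `x 0, …, x (m - 1)` (task `0` outputs their number `m`)
and the relators of a presentation of `K` on them (task `1`). -/
structure ListsPresentation (c : Nat.Partrec.Code) {K : Type v} [Group K] {m : ℕ}
    (x : Fin m → K) : Prop where
  generators : m ∈ c.eval (Nat.pair 0 0)
  relators : Subgroup.normalClosure
      {g : FreeGroup (Fin m) | ∃ l : List (Fin m × Bool), Lists c 1 l ∧ g = FreeGroup.mk l} =
    (FreeGroup.lift x).ker

/-- The machine `c` solves the word problem of `K` (task `2`): on each word it halts with answer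
`1` or `0`, according to whether the word represents the identity. -/
def SolvesWordProblem (c : Nat.Partrec.Code) {K : Type v} [Group K] {m : ℕ}
    (x : Fin m → K) : Prop :=
  ∀ l : List (Fin m × Bool),
    (wordEval x l = 1 → 1 ∈ c.eval (Nat.pair 2 (Encodable.encode l))) ∧
    (wordEval x l ≠ 1 → 0 ∈ c.eval (Nat.pair 2 (Encodable.encode l)))

/-- The machine `c` enumerates the positive cone of the order `r` (task `3`): the listed words
represent positive elements, and every positive element is represented by a listed word. -/
def ListsPositiveCone (c : Nat.Partrec.Code) {K : Type v} [Group K] {m : ℕ}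
    (x : Fin m → K) (r : K → K → Prop) : Prop :=
  {g : K | r 1 g} = {g : K | ∃ l : List (Fin m × Bool), Lists c 3 l ∧ wordEval x l = g}

/-- A recursively enumerated family of groups. -/
def IsRecEnumFamily {G : ℕ → Type u} [∀ i, Group (G i)] {n : ℕ → ℕ}
    (x : ∀ i, Fin (n i) → G i) : Prop :=
  ∃ ξ : ℕ → Nat.Partrec.Code, Computable ξ ∧ ∀ i, ListsPresentation (ξ i) (x i)

/-- A recursively enumerated family of groups with decidable word problem. -/
def IsRecEnumFamilyWithWordProblem {G : ℕ → Type u} [∀ i, Group (G i)] {n : ℕ → ℕ}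
    (x : ∀ i, Fin (n i) → G i) : Prop :=
  ∃ ξ : ℕ → Nat.Partrec.Code, Computable ξ ∧
    ∀ i, ListsPresentation (ξ i) (x i) ∧ SolvesWordProblem (ξ i) (x i)

/-- A recursively enumerated family of groups with computable left-order. -/
def IsRecEnumFamilyWithLeftOrder {G : ℕ → Type u} [∀ i, Group (G i)] {n : ℕ → ℕ}
    (x : ∀ i, Fin (n i) → G i) : Prop :=
  ∃ ξ : ℕ → Nat.Partrec.Code, Computable ξ ∧
    ∀ i, ListsPresentation (ξ i) (x i) ∧
      ∃ r : G i → G i → Prop, IsComputableLeftOrder (x i) r ∧ ListsPositiveCone (ξ i) (x i) r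

/-! ### The direct sum and the double wreath product -/

/-- The direct sum (restricted direct product) of a family of groups. -/
def directSum (G : ℕ → Type u) [∀ i, Group (G i)] : Subgroup (∀ i, G i) where
  carrier := {g | {i | g i ≠ 1}.Finite}
  one_mem' := by simp
  mul_mem' := by
    intro a b ha hb
    refine (Set.Finite.union ha hb).subset fun i hi => ?_
    by_contra h
    simp only [Set.mem_union, Set.mem_ofPred_eq, not_or, not_not] at h
    exact hi (by simp [h.1, h.2])
  inv_mem' := by
    intro a ha
    simpa using ha

/-- The inclusion of the `i`-th summand. -/
def incl (G : ℕ → Type u) [∀ i, Group (G i)] (i : ℕ) : G i →* directSum G :=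
  (MonoidHom.mulSingle G i).codRestrict (directSum G) fun g =>
    (Set.finite_singleton i).subset fun j hj => by
      by_contra h
      exact hj (Pi.mulSingle_eq_of_ne (M := G) h g)

/-- The infinite cyclic group acts on functions by `(q • f) p = f (p q)`. -/
def shift (A : Type u) [Group A] : Multiplicative ℤ →* MulAut (Multiplicative ℤ → A) where
  toFun q :=
    { toFun := fun f p => f (p * q)
      invFun := fun f p => f (p * q⁻¹)
      left_inv := fun f => by funext p; simp
      right_inv := fun f => by funext p; simp
      map_mul' := fun _ _ => rfl }
  map_one' := by ext f p; simp
  map_mul' q q' := by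
    ext f p
    change f (p * (q * q')) = f (p * q * q')
    rw [mul_assoc]

/-- The unrestricted wreath product of `A` with the infinite cyclic group. -/
abbrev Wreath (A : Type u) [Group A] : Type u :=
  SemidirectProduct (Multiplicative ℤ → A) (Multiplicative ℤ) (shift A)

/-- A function as an element of the base group of the wreath product. -/
def base {A : Type u} [Group A] (f : Multiplicative ℤ → A) : Wreath A :=
  SemidirectProduct.inl f

/-- The standard generator of the acting cyclic group (`t` in `A ≀ ⟨t⟩`). -/
def cyc (A : Type u) [Group A] : Wreath A :=
  SemidirectProduct.inr (Multiplicative.ofAdd 1)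

/-- The function equal to `a` on the elements of strictly positive exponent, and `1` elsewhere. -/
def stepFun {A : Type u} [Group A] (a : A) : Multiplicative ℤ → A :=
  fun q => if 0 < q.toAdd then a else 1

/-- The number (counted from `1`) of the generator `x i j` in the concatenated list
`x 0 0, …, x 0 (n 0 - 1), x 1 0, …` of all generators of the direct sum. -/
def genIndex (n : ℕ → ℕ) (i : ℕ) (j : Fin (n i)) : ℕ :=
  (∑ l ∈ Finset.range i, n l) + j + 1

theorem genIndex_injective (n : ℕ → ℕ) :
    Function.Injective fun p : Σ i, Fin (n i) => genIndex n p.1 p.2 := by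
  have key : ∀ (i i' : ℕ) (j : Fin (n i)) (j' : Fin (n i')), i < i' →
      genIndex n i j < genIndex n i' j' := by
    intro i i' j j' h
    have h1 : ∑ l ∈ Finset.range (i + 1), n l ≤ ∑ l ∈ Finset.range i', n l :=
      Finset.sum_le_sum_of_subset (Finset.range_mono h)
    rw [Finset.sum_range_succ] at h1
    have := j.2
    simp only [genIndex]
    omega
  rintro ⟨i, j⟩ ⟨i', j'⟩ h
  rcases lt_trichotomy i i' with hi | rfl | hi
  · exact absurd h (key i i' j j' hi).ne
  · simp only [genIndex] at h
    have : j = j' := Fin.ext (by omega)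
    rw [this]
  · exact absurd h (key i' i j' j hi).ne'

section Construction

variable {G : ℕ → Type u} [∀ i, Group (G i)] {n : ℕ → ℕ}

open Classical in
/-- The function on `⟨s⟩` with value `t` at `s`, value `f_m` at `s ^ (2 ^ m)` where `f_m` is the
step function of the `m`-th generator of the direct sum, and value `1` elsewhere. -/
noncomputable def bigFun (x : ∀ i, Fin (n i) → G i) :
    Multiplicative ℤ → Wreath (directSum G) :=
  fun q =>
    if q.toAdd = 1 then cyc (directSum G)
    else if h : ∃ p : Σ i, Fin (n i), q.toAdd = 2 ^ genIndex n p.1 p.2 then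
      base (stepFun (incl G h.choose.1 (x h.choose.1 h.choose.2)))
    else 1

/-- The choice in the definition of `bigFun` is forced. -/
theorem bigFun_two_pow (x : ∀ i, Fin (n i) → G i) (i : ℕ) (j : Fin (n i)) :
    bigFun x (Multiplicative.ofAdd (2 ^ genIndex n i j)) =
      base (stepFun (incl G i (x i j))) := by
  have h1 : ((2 : ℤ) ^ genIndex n i j) ≠ 1 :=
    (one_lt_pow₀ (by norm_num) (by simp [genIndex])).ne'
  have h : ∃ p : Σ i, Fin (n i), (2 : ℤ) ^ genIndex n i j = 2 ^ genIndex n p.1 p.2 :=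
    ⟨⟨i, j⟩, rfl⟩
  have h2 : h.choose = ⟨i, j⟩ := genIndex_injective n
    (Int.pow_right_injective (by norm_num : 1 < (2 : ℤ).natAbs) h.choose_spec).symm
  simp only [bigFun, toAdd_ofAdd]
  rw [if_neg h1, dif_pos h, h2]

/-- The element `s` of the double wreath product `(⊕ G i) ≀ ⟨t⟩ ≀ ⟨s⟩`. -/
def elemS (G : ℕ → Type u) [∀ i, Group (G i)] : Wreath (Wreath (directSum G)) :=
  cyc (Wreath (directSum G))

/-- The element `F` of the double wreath product `(⊕ G i) ≀ ⟨t⟩ ≀ ⟨s⟩`. -/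
noncomputable def elemF (x : ∀ i, Fin (n i) → G i) : Wreath (Wreath (directSum G)) :=
  base (bigFun x)

/-- The subgroup `H̃` of the double wreath product that is generated by `s` and `F`. -/
noncomputable def Htilde (x : ∀ i, Fin (n i) → G i) : Subgroup (Wreath (Wreath (directSum G))) :=
  Subgroup.closure {elemS G, elemF x}

/-- The generating pair `(s, F)` of `H̃`. -/
noncomputable def HtildeGen (x : ∀ i, Fin (n i) → G i) : Fin 2 → Htilde x :=
  ![⟨elemS G, Subgroup.subset_closure (by simp)⟩, ⟨elemF x, Subgroup.subset_closure (by simp)⟩]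

open scoped commutatorElement in
/-- `[F, s ^ (2 ^ m - 1) F s ^ (-(2 ^ m - 1))]`, where `m` is the number of the generator
`x i j`. -/
noncomputable def PsiGen (x : ∀ i, Fin (n i) → G i) (i : ℕ) (j : Fin (n i)) :
    Wreath (Wreath (directSum G)) :=
  ⁅elemF x,
    elemS G ^ (2 ^ genIndex n i j - 1) * elemF x * (elemS G ^ (2 ^ genIndex n i j - 1))⁻¹⁆

end Construction

end WreathFamily

open WreathFamily

/-!
The function `F` is sparse: its values `t, f_1, f_2, …` sit at the places `1, 2, 4, …`. Since `1` is
the only odd power of `2`, the commutator of `F` with its translate by `2 ^ m - 1` is supported at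
the single place `s`, with value `[t, f_m]`, and this is the function on `⟨t⟩` that is supported at
`1` with value `x_m` (`IsSparse.commutator_eq`). So the embedding is `deltaHom`, which is defined on
the whole direct sum, and the direct sum lands in `H̃` because it does so on generators.

The coordinate at any place of a word in `s, F` is a word in `t, f_1, f_2, …` that can be computed,
and the coordinates of the latter are computable words in `x_1, x_2, …` (`coordWord`). The
algorithms rest on the fact that finitely many coordinates suffice.
* The function part of a word of length `N` in `t, f_1, …` is constant on each side of `[-N, N]`
  (`isDelta_wordEval_stepGen_iff`).
* For a word of length `N` in `s, F`, a place outside `[-3 N, 3 N]` sees at most one power `c` of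
  `2` within the distance `N`. Its coordinate is therefore a power of `F(c)`, and the exponent is
  the exponent of `t` in a coordinate near `0` (`IsSparse.left_wordEval_eq_zpow`). If the coordinates
  near `0` have trivial exponent of `t`, then the coordinates far away are trivial
  (`IsSparse.isDelta_iff`).
* The components of a word in the direct sum vanish beyond a computable index
  (`exists_summand_bound`).
This reduces the word problem and the membership problem to a uniform solution of the word problem
of the groups `G i`.

For the orders, the exponents of `s` and of `t` are compared first, and then the function parts and
the elements of the direct sum lexicographically, along a fixed enumeration of the places
(`lexCone`, `wreathCone`). The first non-trivial coordinate can be found because the word problem is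
decidable. Finally, the order of `G i` is decidable uniformly in `i` although only an enumeration of
its positive cone is given: the presentation makes the trivial words enumerable, hence so are the
positive and the negative words, and every word is of exactly one of the three kinds
(`computablePred_extGen_pos`).
-/

/-! ### Closure properties of computable and recursively enumerable predicates -/

section Computability

variable {α β : Type} [Primcodable α] [Primcodable β]

theorem ComputablePred.comp {p : β → Prop} (hp : ComputablePred p) {f : α → β}
    (hf : Computable f) : ComputablePred fun a => p (f a) := by
  obtain ⟨g, hg, rfl⟩ := ComputablePred.computable_iff.1 hp
  exact ComputablePred.computable_iff.2 ⟨_, hg.comp hf, rfl⟩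

theorem ComputablePred.and {p q : α → Prop} (hp : ComputablePred p) (hq : ComputablePred q) :
    ComputablePred fun a => p a ∧ q a := by
  obtain ⟨f, hf, rfl⟩ := ComputablePred.computable_iff.1 hp
  obtain ⟨g, hg, rfl⟩ := ComputablePred.computable_iff.1 hq
  exact ComputablePred.computable_iff.2
    ⟨_, Primrec.and.to_comp.comp hf hg, by funext a; simp⟩

theorem ComputablePred.or {p q : α → Prop} (hp : ComputablePred p) (hq : ComputablePred q) :
    ComputablePred fun a => p a ∨ q a :=
  (hp.not.and hq.not).not.of_eq fun a => by tauto

theorem ComputablePred.imp {p q : α → Prop} (hp : ComputablePred p) (hq : ComputablePred q) :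
    ComputablePred fun a => p a → q a :=
  (hp.not.or hq).of_eq fun a => by tauto

theorem ComputablePred.forall_lt {p : α → ℕ → Prop}
    (hp : ComputablePred fun a : α × ℕ => p a.1 a.2) {N : α → ℕ} (hN : Computable N) :
    ComputablePred fun a => ∀ k < N a, p a k := by
  obtain ⟨f, hf, hfp⟩ := ComputablePred.computable_iff.1 hp
  have hfp' : ∀ a k, p a k ↔ f (a, k) = true := fun a k => iff_of_eq (congrFun hfp (a, k))
  refine ComputablePred.computable_iff.2
    ⟨fun a => Nat.rec (motive := fun _ => Bool) true (fun y IH => IH && f (a, y)) (N a),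
      Computable.nat_rec (h := fun a y => y.2 && f (a, y.1)) hN (Computable.const true)
        (Primrec.and.to_comp.comp (Computable.snd.comp Computable.snd)
        (hf.comp (Computable.pair Computable.fst (Computable.fst.comp Computable.snd)))), ?_⟩
  funext a
  have key : ∀ m : ℕ, (∀ k < m, p a k) ↔
      Nat.rec (motive := fun _ => Bool) true (fun y IH => IH && f (a, y)) m = true := by
    intro m
    induction m with
    | zero => simp
    | succ m ih => rw [Nat.forall_lt_succ_right, ih, hfp', Bool.and_eq_true]
  exact propext (key (N a))

theorem ComputablePred.re_exists {p : α → β → Prop}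
    (hp : ComputablePred fun a : α × β => p a.1 a.2) : REPred fun a => ∃ b, p a b := by
  obtain ⟨f, hf, hfp⟩ := ComputablePred.computable_iff.1 hp
  have hfp' : ∀ a b, p a b ↔ f (a, b) = true := fun a b => iff_of_eq (congrFun hfp (a, b))
  have hg : Computable₂ fun (a : α) (k : ℕ) =>
      ((Encodable.decode (α := β) k).map fun b => f (a, b)).getD false :=
    Computable.option_getD
      (Computable.option_map (Computable.decode.comp Computable.snd)
        (hf.comp (Computable.pair (Computable.fst.comp Computable.fst) Computable.snd)))
      (Computable.const false)
  refine (Partrec.rfind hg.partrec₂).dom_re.of_eq fun a => ?_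
  rw [Nat.rfind_dom]
  constructor
  · rintro ⟨k, hk, -⟩
    cases h : Encodable.decode (α := β) k with
    | none => simp [h] at hk
    | some b => exact ⟨b, (hfp' a b).2 (by simpa [h] using hk)⟩
  · rintro ⟨b, hb⟩
    exact ⟨Encodable.encode b, by simpa using (hfp' a b).1 hb, by simp⟩

theorem REPred.comp {p : β → Prop} (hp : REPred p) {f : α → β} (hf : Computable f) :
    REPred fun a => p (f a) :=
  Partrec.comp hp hf

theorem REPred.or {p q : α → Prop} (hp : REPred p) (hq : REPred q) :
    REPred fun a => p a ∨ q a := by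
  obtain ⟨k, hk, hk'⟩ := Partrec.merge hp hq fun a x _ y _ => rfl
  refine hk.dom_re.of_eq fun a => ?_
  rw [Part.dom_iff_mem]
  simp [hk']

/-- A predicate `P` that is given by the first place where a sequence of decidable tests fails, and
whose complement is covered by a decidable predicate and by `P` itself after a computable
substitution, is decidable. This is the form in which the positive cones of lexicographic orders
appear. -/
theorem ComputablePred.of_lex {P O : α → Prop} {o p : α → ℕ → Prop} {c : α → Prop} {inv : α → α}
    (hO : ComputablePred O) (ho : ComputablePred fun a : α × ℕ => o a.1 a.2)
    (hp : ComputablePred fun a : α × ℕ => p a.1 a.2) (hc : ComputablePred c)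
    (hinv : Computable inv) (hP : ∀ a, P a ↔ c a ∨ ∃ k, (∀ k' < k, o a k') ∧ p a k)
    (hneg : ∀ a, ¬ P a ↔ O a ∨ P (inv a)) : ComputablePred P := by
  have h1 : ComputablePred fun a : α × ℕ => (∀ k' < a.2, o a.1 k') ∧ p a.1 a.2 :=
    (ComputablePred.forall_lt (p := fun (a : α × ℕ) k' => o a.1 k')
      (ho.comp (Computable.pair (Computable.fst.comp Computable.fst) Computable.snd))
      Computable.snd).and hp
  have h2 : REPred P := (hc.to_re.or
    (ComputablePred.re_exists (p := fun a k => (∀ k' < k, o a k') ∧ p a k) h1)).of_eq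
      fun a => (hP a).symm
  exact ComputablePred.computable_iff_re_compl_re'.2
    ⟨h2, (hO.to_re.or (h2.comp hinv)).of_eq fun a => (hneg a).symm⟩

end Computability

/-! ### Evaluation of words -/

namespace WreathFamily

section Words

variable {β : Type v} {H : Type w} [Group H] (y : β → H)

theorem wordEval_eq_lift (l : List (β × Bool)) :
    wordEval y l = FreeGroup.lift y (FreeGroup.mk l) :=
  rfl

@[simp]
theorem wordEval_nil : wordEval y [] = 1 :=
  rfl

@[simp]
theorem wordEval_cons (a : β × Bool) (l : List (β × Bool)) :
    wordEval y (a :: l) = cond a.2 (y a.1) (y a.1)⁻¹ * wordEval y l := by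
  simp [wordEval]

theorem wordEval_append (l l' : List (β × Bool)) :
    wordEval y (l ++ l') = wordEval y l * wordEval y l' := by
  simp [wordEval]

theorem wordEval_invRev (l : List (β × Bool)) :
    wordEval y (FreeGroup.invRev l) = (wordEval y l)⁻¹ := by
  rw [wordEval_eq_lift, wordEval_eq_lift, ← FreeGroup.inv_mk, map_inv]

theorem map_wordEval {K : Type*} [Group K] (φ : H →* K) (l : List (β × Bool)) :
    φ (wordEval y l) = wordEval (fun b => φ (y b)) l := by
  induction l with
  | nil => simp
  | cons a l ih => rcases a with ⟨b, _ | _⟩ <;> simp [ih]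

theorem wordEval_map {γ : Type*} (f : γ → β) (l : List (γ × Bool)) :
    wordEval y (l.map fun p => (f p.1, p.2)) = wordEval (fun c => y (f c)) l := by
  simp [wordEval, Function.comp_def]

end Words

theorem primrec_invRev {β : Type} [Primcodable β] :
    Primrec (FreeGroup.invRev (α := β)) :=
  Primrec.list_reverse.comp (Primrec.list_map Primrec.id
    ((Primrec.pair (Primrec.fst.comp Primrec.snd)
      (Primrec.not.comp (Primrec.snd.comp Primrec.snd))).to₂))

theorem primrec_reduce {β : Type} [Primcodable β] [DecidableEq β] :
    Primrec (FreeGroup.reduce (α := β)) := by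
  have h : Primrec fun q : (β × Bool) × List (β × Bool) =>
      (List.casesOn (motive := fun _ => List (β × Bool)) q.2 [q.1] fun hd tl =>
        if q.1.1 = hd.1 ∧ q.1.2 = !hd.2 then tl else q.1 :: hd :: tl : List (β × Bool)) := by
    refine Primrec.list_casesOn (f := fun q : (β × Bool) × List (β × Bool) => q.2)
      (h := fun q r => if q.1.1 = r.1.1 ∧ q.1.2 = !r.1.2 then r.2 else q.1 :: r.1 :: r.2)
      Primrec.snd
      (Primrec.list_cons.comp Primrec.fst (Primrec.const ([] : List (β × Bool)))) ?_
    refine Primrec.ite ?_ (Primrec.snd.comp Primrec.snd)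
      (Primrec.list_cons.comp (Primrec.fst.comp Primrec.fst)
        (Primrec.list_cons.comp (Primrec.fst.comp Primrec.snd) (Primrec.snd.comp Primrec.snd)))
    exact (Primrec.eq.comp (Primrec.fst.comp (Primrec.fst.comp Primrec.fst))
      (Primrec.fst.comp (Primrec.fst.comp Primrec.snd))).and
      (Primrec.eq.comp (Primrec.snd.comp (Primrec.fst.comp Primrec.fst))
      (Primrec.not.comp (Primrec.snd.comp (Primrec.fst.comp Primrec.snd))))
  refine (Primrec.list_foldr (f := fun l : List (β × Bool) => l)
    (h := fun _ q => (List.casesOn (motive := fun _ => List (β × Bool)) q.2 [q.1] fun hd tl =>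
        if q.1.1 = hd.1 ∧ q.1.2 = !hd.2 then tl else q.1 :: hd :: tl : List (β × Bool)))
    Primrec.id (Primrec.const []) (h.comp Primrec.snd).to₂).of_eq fun l => ?_
  induction l with
  | nil => rfl
  | cons a l ih => rw [List.foldr_cons, ih, FreeGroup.reduce.cons]

/-! ### Coordinates of words in wreath products -/

section Coordinates

/-- The integer `p.1 - p.2`, as an element of the infinite cyclic group. -/
def pos (p : ℕ × ℕ) : Multiplicative ℤ :=
  Multiplicative.ofAdd ((p.1 : ℤ) - p.2)

/-- The `k`-th element in an enumeration (with repetitions) of the infinite cyclic group. -/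
def enumPos (k : ℕ) : Multiplicative ℤ :=
  pos k.unpair

theorem exists_pos_eq (q : Multiplicative ℤ) :
    ∃ p : ℕ × ℕ, pos p = q ∧ p.1 ≤ q.toAdd.natAbs ∧ p.2 ≤ q.toAdd.natAbs := by
  refine ⟨(q.toAdd.toNat, (-q.toAdd).toNat), ?_, by simp only; omega, by simp only; omega⟩
  apply Multiplicative.toAdd.injective
  simp only [pos, toAdd_ofAdd]
  omega

theorem exists_enumPos_eq (q : Multiplicative ℤ) :
    ∃ k, enumPos k = q ∧ k ≤ Nat.pair q.toAdd.natAbs q.toAdd.natAbs := by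
  obtain ⟨p, hp, h1, h2⟩ := exists_pos_eq q
  refine ⟨Nat.pair p.1 p.2, by simp [enumPos, hp], ?_⟩
  exact (StrictMono.monotone (fun _ _ => Nat.pair_lt_pair_left _) h1).trans
    (StrictMono.monotone (fun _ _ => Nat.pair_lt_pair_right _) h2)

variable {β γ : Type} [DecidableEq β]

/-- One step of the computation of a coordinate of a word in the generators of a wreath product.
The letter `c` stands for the generator of the cyclic group; any other letter `b` stands for a
function whose value at the position `p` is the letter `u b p`, or `1` if `u b p = none`. The state
consists of the current position and of the part of the coordinate that was read off so far. -/
def coordStep (c : β) (u : β → ℕ × ℕ → Option γ) (st : (ℕ × ℕ) × List (γ × Bool))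
    (a : β × Bool) : (ℕ × ℕ) × List (γ × Bool) :=
  if a.1 = c then (cond a.2 (st.1.1 + 1, st.1.2) (st.1.1, st.1.2 + 1), st.2)
  else (st.1, st.2 ++ ((u a.1 st.1).map fun g => (g, a.2)).toList)

/-- The final position and the coordinate of the word `l`, for the starting position `p`. -/
def coordRun (c : β) (u : β → ℕ × ℕ → Option γ) (l : List (β × Bool)) (p : ℕ × ℕ) :
    (ℕ × ℕ) × List (γ × Bool) :=
  l.foldl (coordStep c u) (p, [])

/-- A word that represents the value, at the position `enumPos k`, of the function part of the
element represented by the word `l`. -/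
def coordWord (c : β) (u : β → ℕ × ℕ → Option γ) (l : List (β × Bool)) (k : ℕ) :
    List (γ × Bool) :=
  (coordRun c u l k.unpair).2

/-- The exponent of the cyclic generator in `l`, as a difference of two natural numbers. -/
def expo (c : β) (u : β → ℕ × ℕ → Option γ) (l : List (β × Bool)) : ℕ × ℕ :=
  (coordRun c u l (0, 0)).1

section Eval

variable {K : Type u} [Group K]

@[simp]
theorem cyc_left : (cyc K).left = 1 := rfl

@[simp]
theorem cyc_right : (cyc K).right = Multiplicative.ofAdd 1 := rfl

@[simp]
theorem base_left (f : Multiplicative ℤ → K) : (base f).left = f := rfl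

@[simp]
theorem base_right (f : Multiplicative ℤ → K) : (base f).right = 1 := rfl

theorem wreath_mul_left (g h : Wreath K) (q : Multiplicative ℤ) :
    (g * h).left q = g.left q * h.left (q * g.right) :=
  rfl

theorem cyc_inv : (cyc K)⁻¹ = SemidirectProduct.inr (Multiplicative.ofAdd (-1)) :=
  (map_inv SemidirectProduct.inr (Multiplicative.ofAdd (1 : ℤ))).symm

theorem base_inv (f : Multiplicative ℤ → K) : (base f)⁻¹ = base f⁻¹ :=
  (map_inv SemidirectProduct.inl f).symm

variable {c : β} {u : β → ℕ × ℕ → Option γ} {y : γ → K} {z : β → Wreath K}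

theorem foldl_coordStep (hc : z c = cyc K)
    (hb : ∀ b ≠ c, ∃ f, z b = base f ∧ ∀ p, f (pos p) = (u b p).elim 1 y)
    (l : List (β × Bool)) (p : ℕ × ℕ) (acc : List (γ × Bool)) :
    wordEval y (l.foldl (coordStep c u) (p, acc)).2 =
        wordEval y acc * (wordEval z l).left (pos p) ∧
      pos (l.foldl (coordStep c u) (p, acc)).1 = pos p * (wordEval z l).right := by
  induction l generalizing p acc with
  | nil => simp
  | cons a l ih =>
    rcases a with ⟨b, e⟩
    rw [List.foldl_cons, wordEval_cons]
    by_cases h : b = c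
    · subst h
      -- The letter is the cyclic generator or its inverse: the position moves.
      simp only [coordStep, if_true]
      rcases p with ⟨p1, p2⟩
      obtain ⟨h1, h2⟩ := ih (cond e (p1 + 1, p2) (p1, p2 + 1)) acc
      have h3 : pos (cond e (p1 + 1, p2) (p1, p2 + 1)) =
          pos (p1, p2) * (cond e (z b) (z b)⁻¹).right := by
        cases e <;> apply Multiplicative.toAdd.injective <;> simp [pos, hc] <;> ring
      rw [h1, h2]
      rw [h3]
      constructor
      · cases e <;> simp [hc, wreath_mul_left, cyc_inv]
      · simp [mul_assoc]
    · obtain ⟨f, hf, hfu⟩ := hb b h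
      -- The letter is a function: its value at the current position is appended.
      simp only [coordStep, if_neg h]
      obtain ⟨h1, h2⟩ := ih p (acc ++ ((u b p).map fun g => (g, e)).toList)
      rw [h1, h2]
      constructor
      · rw [wordEval_append, mul_assoc, hf, wreath_mul_left]
        congr 1
        have h4 : wordEval y ((u b p).map fun g => (g, e)).toList =
            (cond e (base f) (base f)⁻¹).left (pos p) := by
          cases hu : u b p <;> cases e <;> simp [base_inv, hfu, hu, wordEval]
        rw [h4]
        cases e <;> simp [base_inv]
      · cases e <;> simp [hf, base_inv]

theorem wordEval_coordRun (hc : z c = cyc K)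
    (hb : ∀ b ≠ c, ∃ f, z b = base f ∧ ∀ p, f (pos p) = (u b p).elim 1 y)
    (l : List (β × Bool)) (p : ℕ × ℕ) :
    wordEval y (coordRun c u l p).2 = (wordEval z l).left (pos p) := by
  simpa [coordRun] using (foldl_coordStep hc hb l p []).1

theorem wordEval_coordWord (hc : z c = cyc K)
    (hb : ∀ b ≠ c, ∃ f, z b = base f ∧ ∀ p, f (pos p) = (u b p).elim 1 y)
    (l : List (β × Bool)) (k : ℕ) :
    wordEval y (coordWord c u l k) = (wordEval z l).left (enumPos k) :=
  wordEval_coordRun hc hb l k.unpair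

theorem pos_expo (hc : z c = cyc K)
    (hb : ∀ b ≠ c, ∃ f, z b = base f ∧ ∀ p, f (pos p) = (u b p).elim 1 y)
    (l : List (β × Bool)) : pos (expo c u l) = (wordEval z l).right := by
  have := (foldl_coordStep hc hb l (0, 0) []).2
  simpa [pos, expo, coordRun] using this

end Eval

section Primrec

variable [Primcodable β] [Primcodable γ] {c : β} {u : β → ℕ × ℕ → Option γ}

theorem primrec_coordStep (hu : Primrec₂ u) : Primrec₂ (coordStep c u) := by
  have hletter : Primrec fun q : ((ℕ × ℕ) × List (γ × Bool)) × (β × Bool) => q.2.1 :=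
    Primrec.fst.comp Primrec.snd
  have hsign : Primrec fun q : ((ℕ × ℕ) × List (γ × Bool)) × (β × Bool) => q.2.2 :=
    Primrec.snd.comp Primrec.snd
  have hpos : Primrec fun q : ((ℕ × ℕ) × List (γ × Bool)) × (β × Bool) => q.1.1 :=
    Primrec.fst.comp Primrec.fst
  have hacc : Primrec fun q : ((ℕ × ℕ) × List (γ × Bool)) × (β × Bool) => q.1.2 :=
    Primrec.snd.comp Primrec.fst
  have h1 := Primrec.fst.comp hpos
  have h2 := Primrec.snd.comp hpos
  refine Primrec.ite (Primrec.eq.comp hletter (Primrec.const c)) ?_ ?_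
  · exact Primrec.pair (Primrec.cond hsign (Primrec.pair (Primrec.succ.comp h1) h2)
      (Primrec.pair h1 (Primrec.succ.comp h2))) hacc
  · exact Primrec.pair hpos (Primrec.list_append.comp hacc (Primrec.optionToList.comp
      (Primrec.option_map (hu.comp hletter hpos)
        (Primrec.pair Primrec.snd (hsign.comp Primrec.fst)).to₂)))

theorem primrec_coordRun (hu : Primrec₂ u) : Primrec₂ (coordRun c u) :=
  Primrec.list_foldl Primrec.fst (Primrec.pair Primrec.snd (Primrec.const []))
    ((primrec_coordStep (c := c) hu).comp (Primrec.fst.comp Primrec.snd)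
      (Primrec.snd.comp Primrec.snd)).to₂

theorem primrec_coordWord (hu : Primrec₂ u) : Primrec₂ (coordWord c u) :=
  Primrec.snd.comp ((primrec_coordRun hu).comp Primrec.fst (Primrec.unpair.comp Primrec.snd))

theorem primrec_expo (hu : Primrec₂ u) : Primrec (expo c u) :=
  Primrec.fst.comp ((primrec_coordRun hu).comp Primrec.id (Primrec.const (0, 0)))

end Primrec

end Coordinates

/-! ### Finitely many coordinates decide -/

section Support

variable {K : Type u} [Group K]

/-- The element `g` of the wreath product lies in the base group, and the function `g.left` has
value `1` outside `q₀`. -/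
def IsDelta (g : Wreath K) (q₀ : Multiplicative ℤ) : Prop :=
  g.right = 1 ∧ ∀ q ≠ q₀, g.left q = 1

theorem IsDelta.eq_base {g : Wreath K} {q₀ : Multiplicative ℤ} (h : IsDelta g q₀) :
    g = base (Pi.mulSingle q₀ (g.left q₀)) := by
  ext q
  · by_cases hq : q = q₀
    · subst hq; simp
    · simp [h.2 q hq, hq]
  · simp [h.1]

theorem isDelta_base_mulSingle (q₀ : Multiplicative ℤ) (a : K) :
    IsDelta (base (Pi.mulSingle q₀ a)) q₀ :=
  ⟨rfl, fun q hq => by simp [hq]⟩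

/-- The generators of the subgroup of `K ≀ ⟨t⟩` that contains the values of `F`: the letter `0`
stands for `t`, and the letter `m > 0` stands for the step function with value `y m`. -/
def stepGen (y : ℕ → K) (m : ℕ) : Wreath K :=
  if m = 0 then cyc K else base (stepFun (y m))

@[simp]
theorem stepGen_zero (y : ℕ → K) : stepGen y 0 = cyc K := rfl

theorem stepGen_of_ne {m : ℕ} (y : ℕ → K) (hm : m ≠ 0) : stepGen y m = base (stepFun (y m)) :=
  if_neg hm

theorem stepGen_right_of_ne {m : ℕ} (y : ℕ → K) (hm : m ≠ 0) : (stepGen y m).right = 1 := by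
  simp [stepGen_of_ne y hm]

/-- The function part of an element of word length `N` is constant to the right of `N`, and
constant to the left of `-N`. -/
theorem left_wordEval_stepGen_eq (y : ℕ → K) (v : List (ℕ × Bool)) {q q' : ℤ}
    (h : (v.length : ℤ) < q ∧ (v.length : ℤ) < q' ∨
      q < -(v.length : ℤ) ∧ q' < -(v.length : ℤ)) :
    (wordEval (stepGen y) v).left (Multiplicative.ofAdd q) =
      (wordEval (stepGen y) v).left (Multiplicative.ofAdd q') := by
  induction v generalizing q q' with
  | nil => simp
  | cons a v ih =>
    rcases a with ⟨m, e⟩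
    rw [List.length_cons] at h
    push_cast at h
    rw [wordEval_cons, wreath_mul_left, wreath_mul_left]
    by_cases hm : m = 0
    · subst hm
      cases e
      · simpa [cyc_inv, div_eq_mul_inv] using ih (q := q - 1) (q' := q' - 1) (by omega)
      · simpa using ih (q := q + 1) (q' := q' + 1) (by omega)
    · have h1 := ih (q := q) (q' := q') (by omega)
      have h2 : (0 < q) ↔ (0 < q') := by omega
      cases e <;> simp [stepGen_of_ne y hm, base_inv, h1, stepFun, h2]

/-- Whether a word of length `N` represents an element of `⟨t⟩`-coordinate `1` whose function part
is supported in `{1}` can be tested on the coordinates in `[-N - 1, N + 1]`. -/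
theorem isDelta_wordEval_stepGen_iff (y : ℕ → K) (v : List (ℕ × Bool)) :
    IsDelta (wordEval (stepGen y) v) 1 ↔ (wordEval (stepGen y) v).right = 1 ∧
      ∀ k < Nat.pair (v.length + 1) (v.length + 1) + 1,
        enumPos k ≠ 1 → (wordEval (stepGen y) v).left (enumPos k) = 1 := by
  refine and_congr_right fun _ => ⟨fun h k _ hk => h _ hk, fun h q hq => ?_⟩
  have near : ∀ q : ℤ, q ≠ 0 → q.natAbs ≤ v.length + 1 →
      (wordEval (stepGen y) v).left (Multiplicative.ofAdd q) = 1 := by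
    intro q hq hle
    obtain ⟨k, hk, hkle⟩ := exists_enumPos_eq (Multiplicative.ofAdd q)
    rw [← hk]
    refine h k (Nat.lt_succ_of_le (hkle.trans ?_)) (by rw [hk]; simpa using hq)
    exact (StrictMono.monotone (fun _ _ => Nat.pair_lt_pair_left _) hle).trans
      (StrictMono.monotone (fun _ _ => Nat.pair_lt_pair_right _) hle)
  have hq' : q.toAdd ≠ 0 := by simpa using hq
  rw [← ofAdd_toAdd q]
  generalize q.toAdd = r at hq'
  by_cases hr : r.natAbs ≤ v.length + 1
  · exact near r hq' hr
  · rcases lt_or_gt_of_ne hq' with h0 | h0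
    · rw [left_wordEval_stepGen_eq y v (q' := -(v.length + 1 : ℤ)) (by omega)]
      exact near _ (by omega) (by omega)
    · rw [left_wordEval_stepGen_eq y v (q' := (v.length + 1 : ℤ)) (by omega)]
      exact near _ (by omega) (by omega)

/-- `Fs` is the function on `⟨s⟩` whose value at `s ^ (2 ^ m)` is the generator `stepGen y m`, and
whose value is `1` elsewhere. -/
structure IsSparse (y : ℕ → K) (Fs : Multiplicative ℤ → Wreath K) : Prop where
  two_pow : ∀ m : ℕ, Fs (Multiplicative.ofAdd (2 ^ m)) = stepGen y m
  other : ∀ q : ℤ, (∀ m : ℕ, q ≠ 2 ^ m) → Fs (Multiplicative.ofAdd q) = 1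

variable {y : ℕ → K} {Fs : Multiplicative ℤ → Wreath K}

theorem IsSparse.one (hF : IsSparse y Fs) : Fs (Multiplicative.ofAdd 1) = cyc K := by
  simpa using hF.two_pow 0

theorem IsSparse.right_eq (hF : IsSparse y Fs) {q : ℤ} (hq : q ≠ 1) :
    (Fs (Multiplicative.ofAdd q)).right = 1 := by
  by_cases h : ∃ m : ℕ, q = 2 ^ m
  · obtain ⟨m, rfl⟩ := h
    rw [hF.two_pow]
    exact stepGen_right_of_ne y (by rintro rfl; simp at hq)
  · rw [hF.other q (by simpa using h), SemidirectProduct.one_right]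

/-- The pair of generators of the double wreath product: the cyclic generator, and `Fs`. -/
def pairGen (Fs : Multiplicative ℤ → Wreath K) : Fin 2 → Wreath (Wreath K) :=
  ![cyc (Wreath K), base Fs]

/-- Suppose that `Fs` has value `1` on the interval of radius `N` around `p`, with the possible
exception of `c`. Then the coordinate at `p` of an element of word length `N` is a power of
`Fs c`, and the exponent is the exponent of `t` in the coordinate at `p - c + 1`: the letters that
contribute `Fs c` to the former are those that contribute `t = Fs 1` to the latter. -/
theorem IsSparse.left_wordEval_eq_zpow (hF : IsSparse y Fs) (w : List (Fin 2 × Bool)) {p c : ℤ}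
    (h : ∀ r : ℤ, |r - p| ≤ w.length → r ≠ c → Fs (Multiplicative.ofAdd r) = 1) :
    (wordEval (pairGen Fs) w).left (Multiplicative.ofAdd p) = Fs (Multiplicative.ofAdd c) ^
      ((wordEval (pairGen Fs) w).left (Multiplicative.ofAdd (p - c + 1))).right.toAdd := by
  induction w generalizing p with
  | nil => simp
  | cons a w ih =>
    rcases a with ⟨b, e⟩
    rw [List.length_cons] at h
    push_cast at h
    rw [wordEval_cons, wreath_mul_left, wreath_mul_left]
    fin_cases b
    · cases e
      · have := ih (p := p - 1) (fun r hr => h r (by rw [abs_le] at hr ⊢; omega))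
        rw [show p - 1 - c + 1 = p - c + 1 + -1 by ring, sub_eq_add_neg] at this
        simpa [pairGen, cyc_inv, ofAdd_add] using this
      · have := ih (p := p + 1) (fun r hr => h r (by rw [abs_le] at hr ⊢; omega))
        have h1 : p - c + 1 + 1 = p + 1 - c + 1 := by ring
        simpa [pairGen, ← ofAdd_add, h1] using this
    · have h2 := ih (p := p) (fun r hr => h r (by rw [abs_le] at hr ⊢; omega))
      have h3 : Fs (Multiplicative.ofAdd p) = Fs (Multiplicative.ofAdd c) ^
          (Fs (Multiplicative.ofAdd (p - c + 1))).right.toAdd := by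
        -- Only `Fs 1 = t` has a non-trivial exponent of `t`, and `p - c + 1 = 1` means `p = c`.
        by_cases hpc : p = c
        · subst hpc
          simp [hF.one]
        · rw [hF.right_eq (by omega), h p (by simp; positivity) hpc]
          simp
      cases e
      · simp only [pairGen, base_inv, Fin.mk_one, Matrix.cons_val_one, Matrix.cons_val_fin_one,
          cond_false, base_left, base_right, mul_one, Pi.inv_apply, SemidirectProduct.mul_right,
          SemidirectProduct.inv_right, toAdd_mul, toAdd_inv, zpow_add, zpow_neg] at h2 ⊢
        rw [← h3, h2]
      · simp only [pairGen, Fin.mk_one, Matrix.cons_val_one, Matrix.cons_val_fin_one,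
          cond_true, base_left, base_right, mul_one, SemidirectProduct.mul_right,
          toAdd_mul, zpow_add] at h2 ⊢
        rw [← h3, h2]

/-- Far away from `0`, an interval of radius `N` contains at most one power of `2`. -/
theorem exists_center (hF : IsSparse y Fs) (N : ℕ) {p : ℤ} (hp : 3 * (N : ℤ) < |p|) :
    ∃ c : ℤ, |c - p| ≤ N ∧ ∀ r : ℤ, |r - p| ≤ N → r ≠ c → Fs (Multiplicative.ofAdd r) = 1 := by
  by_cases h : ∃ m : ℕ, |(2 : ℤ) ^ m - p| ≤ N
  · obtain ⟨m, hm⟩ := h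
    refine ⟨2 ^ m, hm, fun r hr hrc => hF.other r ?_⟩
    rintro l rfl
    have key : ∀ a b : ℕ, a < b → |(2 : ℤ) ^ a - p| ≤ N → |(2 : ℤ) ^ b - p| ≤ N → False := by
      intro a b hab ha hb
      -- The powers differ by at least `2 ^ a ≥ |p| - N > 2 * N`.
      have h1 : (2 : ℤ) ^ (a + 1) ≤ 2 ^ b := pow_le_pow_right₀ (by norm_num) hab
      have h2 : (0 : ℤ) < 2 ^ a := by positivity
      rw [pow_succ] at h1
      rw [abs_le] at ha hb
      rw [lt_abs] at hp
      omega
    rcases lt_trichotomy m l with hml | rfl | hml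
    · exact key m l hml hm hr
    · exact hrc rfl
    · exact key l m hml hr hm
  · push Not at h
    refine ⟨p, by simp, fun r hr _ => hF.other r ?_⟩
    rintro m rfl
    exact absurd hr (not_le.2 (h m))

/-- The image of `K` in the double wreath product consists of the elements that are supported at
`s`, with a value that is supported at `1`. For a word of length `N` with trivial exponent of `t` at
`s`, the support condition can be tested on the coordinates in `[-3 N - 1, 3 N + 1]`. -/
theorem IsSparse.isDelta_iff (hF : IsSparse y Fs) (w : List (Fin 2 × Bool))
    (h1 : ((wordEval (pairGen Fs) w).left (Multiplicative.ofAdd 1)).right = 1) :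
    IsDelta (wordEval (pairGen Fs) w) (Multiplicative.ofAdd 1) ↔
      (wordEval (pairGen Fs) w).right = 1 ∧
        ∀ k < Nat.pair (3 * w.length + 1) (3 * w.length + 1) + 1,
          enumPos k ≠ Multiplicative.ofAdd 1 →
            (wordEval (pairGen Fs) w).left (enumPos k) = 1 := by
  refine and_congr_right fun _ => ⟨fun h k _ hk => h _ hk, fun h q hq => ?_⟩
  have near : ∀ q : ℤ, q ≠ 1 → q.natAbs ≤ 3 * w.length + 1 →
      (wordEval (pairGen Fs) w).left (Multiplicative.ofAdd q) = 1 := by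
    intro q hq hle
    obtain ⟨k, hk, hkle⟩ := exists_enumPos_eq (Multiplicative.ofAdd q)
    rw [← hk]
    refine h k (Nat.lt_succ_of_le (hkle.trans ?_)) (by rw [hk]; simpa using hq)
    exact (StrictMono.monotone (fun _ _ => Nat.pair_lt_pair_left _) hle).trans
      (StrictMono.monotone (fun _ _ => Nat.pair_lt_pair_right _) hle)
  have hq' : q.toAdd ≠ 1 := fun h => hq (by rw [← ofAdd_toAdd q, h])
  rw [← ofAdd_toAdd q]
  generalize q.toAdd = r at hq'
  by_cases hr : r.natAbs ≤ 3 * w.length + 1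
  · exact near r hq' hr
  · obtain ⟨c, hc, hc'⟩ := exists_center hF w.length (p := r)
      (by rw [Int.abs_eq_natAbs]; omega)
    rw [hF.left_wordEval_eq_zpow w hc']
    -- The position `r - c + 1` is within `N + 1` of `0`, so that its coordinate is known.
    have h2 : ((wordEval (pairGen Fs) w).left (Multiplicative.ofAdd (r - c + 1))).right = 1 := by
      by_cases hrc : r = c
      · simpa [hrc] using h1
      · rw [abs_le] at hc
        rw [near _ (by omega) (by omega), SemidirectProduct.one_right]
    rw [h2, toAdd_one, zpow_zero]

end Support

/-! ### Deciding words in the double wreath product -/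

section WreathWords

/-- The step function of the letter `m` has value `m` at the positions with `p.2 < p.1`. -/
def stepCoord (m : ℕ) (p : ℕ × ℕ) : Option ℕ :=
  if p.2 < p.1 then some m else none

/-- The value of the sparse function at a position: the letter `m`, if the position is `2 ^ m`. -/
def sparseCoord (_ : Fin 2) (p : ℕ × ℕ) : Option ℕ :=
  if p.2 + 2 ^ Nat.findGreatest (fun m => p.2 + 2 ^ m ≤ p.1) p.1 = p.1 then
    some (Nat.findGreatest (fun m => p.2 + 2 ^ m ≤ p.1) p.1)
  else none

theorem sparseCoord_eq_some_iff {b : Fin 2} {p : ℕ × ℕ} {m : ℕ} :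
    sparseCoord b p = some m ↔ p.2 + 2 ^ m = p.1 := by
  unfold sparseCoord
  constructor
  · intro h
    split_ifs at h with h1
    · rw [Option.some.injEq] at h
      rwa [h] at h1
  · intro h
    have hle : m ≤ p.1 := by
      have := Nat.lt_two_pow_self (n := m)
      omega
    have h1 : m ≤ Nat.findGreatest (fun m => p.2 + 2 ^ m ≤ p.1) p.1 :=
      Nat.le_findGreatest hle h.le
    have h2 : p.2 + 2 ^ Nat.findGreatest (fun m => p.2 + 2 ^ m ≤ p.1) p.1 ≤ p.1 :=
      Nat.findGreatest_spec (P := fun m => p.2 + 2 ^ m ≤ p.1) hle h.le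
    have h3 : Nat.findGreatest (fun m => p.2 + 2 ^ m ≤ p.1) p.1 = m := by
      refine le_antisymm ?_ h1
      exact (Nat.pow_le_pow_iff_right (by norm_num : 1 < 2)).1 (by omega)
    rw [h3, if_pos h]

theorem primrec_stepCoord : Primrec₂ stepCoord :=
  Primrec.ite (Primrec.nat_lt.comp (Primrec.snd.comp Primrec.snd) (Primrec.fst.comp Primrec.snd))
    (Primrec.option_some.comp Primrec.fst) (Primrec.const none)

theorem primrec_two_pow : Primrec fun m : ℕ => 2 ^ m :=
  (Primrec₂.unpaired'.1 Nat.Primrec.pow).comp (Primrec.const 2) Primrec.id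

theorem primrec_sparseCoord : Primrec₂ sparseCoord := by
  have h1 : Primrec fun q : Fin 2 × (ℕ × ℕ) => q.2.1 := Primrec.fst.comp Primrec.snd
  have h2 : Primrec fun q : Fin 2 × (ℕ × ℕ) => q.2.2 := Primrec.snd.comp Primrec.snd
  have hg : Primrec fun q : Fin 2 × (ℕ × ℕ) =>
      Nat.findGreatest (fun m => q.2.2 + 2 ^ m ≤ q.2.1) q.2.1 :=
    Primrec.nat_findGreatest (p := fun (q : Fin 2 × (ℕ × ℕ)) m => q.2.2 + 2 ^ m ≤ q.2.1) h1
      (Primrec.nat_le.comp (Primrec.nat_add.comp (h2.comp Primrec.fst)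
        (primrec_two_pow.comp Primrec.snd)) (h1.comp Primrec.fst))
  exact Primrec.ite (Primrec.eq.comp (Primrec.nat_add.comp h2 (primrec_two_pow.comp hg)) h1)
    (Primrec.option_some.comp hg) (Primrec.const none)

/-- A word in the values of the step functions, for the coordinate number `k` of the word `v`. -/
abbrev stepWord : List (ℕ × Bool) → ℕ → List (ℕ × Bool) :=
  coordWord 0 stepCoord

/-- A word in the values of the sparse function, for the coordinate number `k` of the word `w`. -/
abbrev sparseWord : List (Fin 2 × Bool) → ℕ → List (ℕ × Bool) :=
  coordWord 0 sparseCoord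

theorem primrec_stepWord : Primrec₂ stepWord :=
  primrec_coordWord primrec_stepCoord

theorem primrec_sparseWord : Primrec₂ sparseWord :=
  primrec_coordWord primrec_sparseCoord

variable {K : Type u} [Group K] {y : ℕ → K} {Fs : Multiplicative ℤ → Wreath K}

theorem stepGen_coord (y : ℕ → K) (m : ℕ) (hm : m ≠ 0) :
    ∃ f, stepGen y m = base f ∧ ∀ p, f (pos p) = (stepCoord m p).elim 1 y := by
  refine ⟨_, stepGen_of_ne y hm, fun p => ?_⟩
  by_cases h : p.2 < p.1 <;> simp [stepFun, pos, stepCoord, h]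

theorem IsSparse.coord (hF : IsSparse y Fs) (b : Fin 2) (hb : b ≠ 0) :
    ∃ f, pairGen Fs b = base f ∧ ∀ p, f (pos p) = (sparseCoord b p).elim 1 (stepGen y) := by
  obtain rfl : b = 1 := by omega
  refine ⟨Fs, rfl, fun p => ?_⟩
  cases h : sparseCoord 1 p with
  | none =>
    refine hF.other _ fun m hm => ?_
    have : sparseCoord 1 p = some m := sparseCoord_eq_some_iff.2 (by zify; omega)
    simp [h] at this
  | some m =>
    have h1 := sparseCoord_eq_some_iff.1 h
    have h2 : (p.1 : ℤ) - p.2 = 2 ^ m := by zify at h1; omega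
    rw [pos, h2, hF.two_pow]
    rfl

theorem wordEval_stepWord (y : ℕ → K) (v : List (ℕ × Bool)) (k : ℕ) :
    wordEval y (stepWord v k) = (wordEval (stepGen y) v).left (enumPos k) :=
  wordEval_coordWord (stepGen_zero y) (stepGen_coord y) v k

theorem pos_expo_step (y : ℕ → K) (v : List (ℕ × Bool)) :
    pos (expo 0 stepCoord v) = (wordEval (stepGen y) v).right :=
  pos_expo (stepGen_zero y) (stepGen_coord y) v

theorem IsSparse.wordEval_sparseWord (hF : IsSparse y Fs) (w : List (Fin 2 × Bool)) (k : ℕ) :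
    wordEval (stepGen y) (sparseWord w k) = (wordEval (pairGen Fs) w).left (enumPos k) :=
  wordEval_coordWord (z := pairGen Fs) rfl hF.coord w k

theorem IsSparse.pos_expo_sparse (hF : IsSparse y Fs) (w : List (Fin 2 × Bool)) :
    pos (expo 0 sparseCoord w) = (wordEval (pairGen Fs) w).right :=
  pos_expo (z := pairGen Fs) rfl hF.coord w

theorem pos_eq_one_iff {p : ℕ × ℕ} : pos p = 1 ↔ p.1 = p.2 := by
  rw [← Multiplicative.toAdd.injective.eq_iff]
  simp only [pos, toAdd_ofAdd, toAdd_one]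
  omega

theorem pos_eq_ofAdd_one_iff {p : ℕ × ℕ} :
    pos p = Multiplicative.ofAdd 1 ↔ p.1 = p.2 + 1 := by
  rw [← Multiplicative.toAdd.injective.eq_iff]
  simp only [pos, toAdd_ofAdd]
  omega

theorem toAdd_pos_pos_iff {p : ℕ × ℕ} : 0 < (pos p).toAdd ↔ p.2 < p.1 := by
  simp [pos]

@[simp]
theorem enumPos_zero : enumPos 0 = 1 := by
  simp [enumPos, pos]

@[simp]
theorem enumPos_pair_one_zero : enumPos (Nat.pair 1 0) = Multiplicative.ofAdd 1 := by
  simp [enumPos, pos]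

theorem computablePred_enumPos_eq_one : ComputablePred fun k => enumPos k = 1 := by
  refine PrimrecPred.computablePred (PrimrecPred.of_eq (p := fun k : ℕ => k.unpair.1 = k.unpair.2)
    ?_ fun k => pos_eq_one_iff.symm)
  exact Primrec.eq.comp (Primrec.fst.comp Primrec.unpair) (Primrec.snd.comp Primrec.unpair)

theorem computablePred_enumPos_eq_ofAdd_one :
    ComputablePred fun k => enumPos k = Multiplicative.ofAdd 1 := by
  refine PrimrecPred.computablePred (PrimrecPred.of_eq
    (p := fun k : ℕ => k.unpair.1 = k.unpair.2 + 1) ?_ fun k => pos_eq_ofAdd_one_iff.symm)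
  exact Primrec.eq.comp (Primrec.fst.comp Primrec.unpair)
    (Primrec.succ.comp (Primrec.snd.comp Primrec.unpair))

theorem computablePred_pos_comp_eq_one {α : Type} [Primcodable α] {f : α → ℕ × ℕ}
    (hf : Primrec f) : ComputablePred fun a => pos (f a) = 1 :=
  PrimrecPred.computablePred (PrimrecPred.of_eq
    (Primrec.eq.comp (Primrec.fst.comp hf) (Primrec.snd.comp hf)) fun _ => pos_eq_one_iff.symm)

theorem computablePred_pos_comp_pos {α : Type} [Primcodable α] {f : α → ℕ × ℕ}
    (hf : Primrec f) : ComputablePred fun a => 0 < (pos (f a)).toAdd :=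
  PrimrecPred.computablePred (PrimrecPred.of_eq
    (Primrec.nat_lt.comp (Primrec.snd.comp hf) (Primrec.fst.comp hf))
      fun _ => toAdd_pos_pos_iff.symm)

theorem computablePred_step_right_eq_one (y : ℕ → K) :
    ComputablePred fun v => (wordEval (stepGen y) v).right = 1 :=
  (computablePred_pos_comp_eq_one (primrec_expo primrec_stepCoord)).of_eq
    fun v => by rw [pos_expo_step y]

theorem IsSparse.computablePred_right_eq_one (hF : IsSparse y Fs) :
    ComputablePred fun w => (wordEval (pairGen Fs) w).right = 1 :=
  (computablePred_pos_comp_eq_one (primrec_expo primrec_sparseCoord)).of_eq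
    fun w => by rw [hF.pos_expo_sparse]

/-- The bound `pair (N + 1) (N + 1) + 1` for the numbers of the positions in `[-N - 1, N + 1]`. -/
theorem primrec_pair_bound {α : Type} [Primcodable α] {f : α → ℕ} (hf : Primrec f) :
    Primrec fun a => Nat.pair (f a + 1) (f a + 1) + 1 :=
  Primrec.succ.comp (Primrec₂.natPair.comp (Primrec.succ.comp hf) (Primrec.succ.comp hf))

theorem computablePred_stepWord_eq_one (hO : ComputablePred fun z => wordEval y z = 1) :
    ComputablePred fun a : List (ℕ × Bool) × ℕ =>
      (wordEval (stepGen y) a.1).left (enumPos a.2) = 1 :=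
  (hO.comp primrec_stepWord.to_comp).of_eq fun a => by
    rw [wordEval_stepWord]

theorem computablePred_step_isDelta (hO : ComputablePred fun z => wordEval y z = 1) :
    ComputablePred fun v => IsDelta (wordEval (stepGen y) v) 1 := by
  refine ((computablePred_step_right_eq_one y).and (ComputablePred.forall_lt
    (p := fun v k => enumPos k ≠ 1 → (wordEval (stepGen y) v).left (enumPos k) = 1) ?_
    (primrec_pair_bound Primrec.list_length).to_comp)).of_eq
    fun v => (isDelta_wordEval_stepGen_iff y v).symm
  exact (computablePred_enumPos_eq_one.comp Computable.snd).not.imp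
    (computablePred_stepWord_eq_one hO)

theorem computablePred_step_eq_one (hO : ComputablePred fun z => wordEval y z = 1) :
    ComputablePred fun v => wordEval (stepGen y) v = 1 := by
  refine ((computablePred_step_isDelta hO).and ((computablePred_stepWord_eq_one hO).comp
    (Computable.pair Computable.id (Computable.const 0)))).of_eq fun v => ?_
  constructor
  · rintro ⟨h1, h2⟩
    rw [id, enumPos_zero] at h2
    rw [h1.eq_base, h2, Pi.mulSingle_one]
    rfl
  · intro h
    simp [h, IsDelta]

theorem IsSparse.computablePred_sparseWord_eq_one 
    (hO : ComputablePred fun z => wordEval y z = 1) (hF : IsSparse y Fs) :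
    ComputablePred fun a : List (Fin 2 × Bool) × ℕ =>
      (wordEval (pairGen Fs) a.1).left (enumPos a.2) = 1 :=
  ((computablePred_step_eq_one hO).comp primrec_sparseWord.to_comp).of_eq fun a => by
    rw [hF.wordEval_sparseWord]

/-- It is decidable whether a word represents an element of the image of `K`. -/
theorem IsSparse.computablePred_isDelta 
    (hO : ComputablePred fun z => wordEval y z = 1) (hF : IsSparse y Fs) :
    ComputablePred fun w => IsDelta (wordEval (pairGen Fs) w) (Multiplicative.ofAdd 1) ∧
      IsDelta ((wordEval (pairGen Fs) w).left (Multiplicative.ofAdd 1)) 1 := by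
  have h1 : ComputablePred fun w =>
      IsDelta ((wordEval (pairGen Fs) w).left (Multiplicative.ofAdd 1)) 1 :=
    ((computablePred_step_isDelta hO).comp
      (primrec_sparseWord.comp Primrec.id (Primrec.const (Nat.pair 1 0))).to_comp).of_eq
      fun w => by rw [hF.wordEval_sparseWord, id, enumPos_pair_one_zero]
  have h2 : ComputablePred fun w : List (Fin 2 × Bool) =>
      ∀ k < Nat.pair (3 * w.length + 1) (3 * w.length + 1) + 1,
        enumPos k ≠ Multiplicative.ofAdd 1 →
          (wordEval (pairGen Fs) w).left (enumPos k) = 1 := by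
    refine ComputablePred.forall_lt (p := fun w k => enumPos k ≠ Multiplicative.ofAdd 1 →
      (wordEval (pairGen Fs) w).left (enumPos k) = 1) ?_ (primrec_pair_bound
        (Primrec.nat_mul.comp (Primrec.const 3) Primrec.list_length)).to_comp
    exact (computablePred_enumPos_eq_ofAdd_one.comp Computable.snd).not.imp
      (IsSparse.computablePred_sparseWord_eq_one hO hF)
  refine ((hF.computablePred_right_eq_one.and h2).and h1).of_eq fun w => ?_
  exact and_congr_left fun h => (hF.isDelta_iff w h.1).symm

end WreathWords

/-! ### The direct sum -/

section DirectSum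

variable {G : ℕ → Type u} [∀ i, Group (G i)] {n : ℕ → ℕ}

/-- A finite tuple of generators, extended by `1`. -/
def extGen {K : Type u} [Group K] {m : ℕ} (x : Fin m → K) (j : ℕ) : K :=
  if h : j < m then x ⟨j, h⟩ else 1

open Classical in
/-- The `m`-th generator of the direct sum (counted from `1`), or `1` if there is none. -/
noncomputable def sumGen (x : ∀ i, Fin (n i) → G i) (m : ℕ) : directSum G :=
  if h : ∃ p : Σ i, Fin (n i), m = genIndex n p.1 p.2 then
    incl G h.choose.1 (x h.choose.1 h.choose.2)
  else 1

theorem sumGen_genIndex (x : ∀ i, Fin (n i) → G i) (i : ℕ) (j : Fin (n i)) :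
    sumGen x (genIndex n i j) = incl G i (x i j) := by
  have h : ∃ p : Σ i, Fin (n i), genIndex n i j = genIndex n p.1 p.2 := ⟨⟨i, j⟩, rfl⟩
  have h2 : h.choose = ⟨i, j⟩ := (genIndex_injective n h.choose_spec).symm
  rw [sumGen, dif_pos h, h2]

/-- The number of generators of the first `i` groups. -/
def numGens (n : ℕ → ℕ) (i : ℕ) : ℕ :=
  ∑ l ∈ Finset.range i, n l

theorem numGens_succ (i : ℕ) : numGens n (i + 1) = numGens n i + n i :=
  Finset.sum_range_succ _ _

theorem numGens_mono : Monotone (numGens n) :=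
  fun _ _ h => Finset.sum_le_sum_of_subset (Finset.range_mono h)

theorem incl_apply_same (i : ℕ) (a : G i) : (incl G i a).1 i = a :=
  Pi.mulSingle_eq_same (M := G) i a

theorem incl_apply_of_ne {i i' : ℕ} (h : i' ≠ i) (a : G i) : (incl G i a).1 i' = 1 :=
  Pi.mulSingle_eq_of_ne (M := G) h a

theorem sumGen_apply (x : ∀ i, Fin (n i) → G i) (m i : ℕ) :
    (sumGen x m).1 i = if numGens n i < m then extGen (x i) (m - numGens n i - 1) else 1 := by
  by_cases h : ∃ p : Σ i, Fin (n i), m = genIndex n p.1 p.2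
  · obtain ⟨⟨i', j⟩, rfl⟩ := h
    simp only
    rw [sumGen_genIndex]
    have hj := j.2
    have hidx : genIndex n i' j = numGens n i' + j + 1 := rfl
    rcases lt_trichotomy i i' with hi | rfl | hi
    · have h1 := numGens_mono (n := n) hi
      rw [Nat.succ_eq_add_one, numGens_succ] at h1
      rw [incl_apply_of_ne hi.ne, if_pos (by omega), extGen, dif_neg (by omega)]
    · have h1 : genIndex n i j - numGens n i - 1 = j := by omega
      rw [incl_apply_same, if_pos (by omega), h1, extGen, dif_pos hj]
    · have h1 := numGens_mono (n := n) hi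
      rw [Nat.succ_eq_add_one, numGens_succ] at h1
      rw [incl_apply_of_ne hi.ne', if_neg (by omega)]
  · rw [sumGen, dif_neg h]
    split_ifs with hm
    · rw [extGen, dif_neg]
      · rfl
      · intro hlt
        exact h ⟨⟨i, ⟨_, hlt⟩⟩, by simp only [genIndex]; unfold numGens at *; omega⟩
    · rfl

/-- The component of a word in one summand, where `lo` generators belong to the previous summands.
Letters with a too large number remain; they stand for `1`. -/
def compWord (lo : ℕ) (z : List (ℕ × Bool)) : List (ℕ × Bool) :=
  z.filterMap fun p => if lo < p.1 then some (p.1 - lo - 1, p.2) else none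

theorem primrec_compWord : Primrec₂ compWord := by
  refine Primrec.listFilterMap Primrec.snd (Primrec.ite ?_ ?_ (Primrec.const none))
  · exact Primrec.nat_lt.comp (Primrec.fst.comp Primrec.fst) (Primrec.fst.comp Primrec.snd)
  · exact Primrec.option_some.comp (Primrec.pair (Primrec.nat_sub.comp (Primrec.nat_sub.comp
      (Primrec.fst.comp Primrec.snd) (Primrec.fst.comp Primrec.fst)) (Primrec.const 1))
      (Primrec.snd.comp Primrec.snd))

theorem wordEval_compWord (x : ∀ i, Fin (n i) → G i) (z : List (ℕ × Bool)) (i : ℕ) :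
    wordEval (extGen (x i)) (compWord (numGens n i) z) = (wordEval (sumGen x) z).1 i := by
  induction z with
  | nil => rfl
  | cons a z ih =>
    rcases a with ⟨m, e⟩
    have h1 : (wordEval (sumGen x) ((m, e) :: z)).1 i =
        cond e ((sumGen x m).1 i) ((sumGen x m).1 i)⁻¹ * (wordEval (sumGen x) z).1 i := by
      rw [wordEval_cons]
      cases e <;> rfl
    rw [h1, sumGen_apply, ← ih]
    by_cases h : numGens n i < m
    · simp [compWord, h]
    · cases e <;> simp [compWord, h]

theorem computable_numGens (hn : Computable n) : Computable (numGens n) := by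
  refine (Computable.nat_rec (h := fun (_ : ℕ) (q : ℕ × ℕ) => q.2 + n q.1) Computable.id
    (Computable.const 0) (Primrec.nat_add.to_comp.comp (Computable.snd.comp Computable.snd)
      (hn.comp (Computable.fst.comp Computable.snd)))).of_eq fun i => ?_
  induction i with
  | zero => rfl
  | succ i ih => simp only [id] at ih ⊢; rw [numGens_succ, ← ih]

/-- There is a computable bound for the summands in which the first `M` generators have a
non-trivial component. If there are infinitely many generators, then it is found by a search;
otherwise the groups are eventually trivial. -/
theorem exists_summand_bound (hn : Computable n) (x : ∀ i, Fin (n i) → G i) :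
    ∃ I : ℕ → ℕ, Computable I ∧ ∀ M i, I M ≤ i → ∀ m ≤ M, (sumGen x m).1 i = 1 := by
  by_cases h : ∀ M, ∃ i, M ≤ numGens n i
  · refine ⟨fun M => Nat.find (h M), Computable.find (P := fun M i => M ≤ numGens n i) ?_ h,
      fun M i hi m hm => ?_⟩
    · exact (PrimrecPred.computablePred (p := fun q : ℕ × ℕ => q.1 ≤ q.2) Primrec.nat_le).comp
        (Computable.pair Computable.fst ((computable_numGens hn).comp Computable.snd))
    · have h1 : M ≤ numGens n (Nat.find (h M)) := Nat.find_spec (h M)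
      have h2 : numGens n (Nat.find (h M)) ≤ numGens n i := numGens_mono hi
      rw [sumGen_apply, if_neg (by omega)]
  · push Not at h
    obtain ⟨M, hM⟩ := h
    have hbdd : BddAbove (Set.range (numGens n)) := ⟨M, by rintro _ ⟨i, rfl⟩; exact (hM i).le⟩
    obtain ⟨i₀, hi₀⟩ := Nat.sSup_mem (Set.range_nonempty (numGens n)) hbdd
    refine ⟨fun _ => i₀, Computable.const i₀, fun _ i hi m _ => ?_⟩
    have h1 : numGens n (i + 1) ≤ numGens n i₀ := hi₀ ▸ le_csSup hbdd ⟨i + 1, rfl⟩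
    have h2 : numGens n i₀ ≤ numGens n i := numGens_mono hi
    rw [numGens_succ] at h1
    have h3 : n i = 0 := by omega
    rw [sumGen_apply, extGen, dif_neg (by omega), ite_self]

/-- A bound for the letters of a word. -/
def letterBound (z : List (ℕ × Bool)) : ℕ :=
  z.foldr (fun p N => p.1 + N) 0

theorem primrec_letterBound : Primrec letterBound :=
  Primrec.list_foldr (h := fun _ (q : (ℕ × Bool) × ℕ) => q.1.1 + q.2) Primrec.id (Primrec.const 0)
    (Primrec.nat_add.comp (Primrec.fst.comp (Primrec.fst.comp Primrec.snd))
      (Primrec.snd.comp Primrec.snd)).to₂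

theorem wordEval_sumGen_apply_eq_one {x : ∀ i, Fin (n i) → G i} {I : ℕ → ℕ}
    (hI : ∀ M i, I M ≤ i → ∀ m ≤ M, (sumGen x m).1 i = 1) (z : List (ℕ × Bool)) {i : ℕ}
    (hi : I (letterBound z) ≤ i) : (wordEval (sumGen x) z).1 i = 1 := by
  have key : ∀ (M : ℕ) (l : List (ℕ × Bool)), I M ≤ i → letterBound l ≤ M →
      (wordEval (sumGen x) l).1 i = 1 := by
    intro M l hM
    induction l with
    | nil => intro _; rfl
    | cons a l ih =>
      rcases a with ⟨m, e⟩
      intro hl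
      have hl' : m + letterBound l ≤ M := hl
      have h1 : (wordEval (sumGen x) ((m, e) :: l)).1 i =
          cond e ((sumGen x m).1 i) ((sumGen x m).1 i)⁻¹ * (wordEval (sumGen x) l).1 i := by
        rw [wordEval_cons]
        cases e <;> rfl
      rw [h1, ih (by omega), hI M i hM m (by omega)]
      cases e <;> simp
  exact key _ z hi le_rfl

theorem computablePred_component_eq_one (hn : Computable n) {x : ∀ i, Fin (n i) → G i}
    (h1 : ComputablePred fun a : ℕ × List (ℕ × Bool) => wordEval (extGen (x a.1)) a.2 = 1) :
    ComputablePred fun a : List (ℕ × Bool) × ℕ => (wordEval (sumGen x) a.1).1 a.2 = 1 :=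
  (h1.comp (Computable.pair Computable.snd (primrec_compWord.to_comp.comp
    ((computable_numGens hn).comp Computable.snd) Computable.fst))).of_eq
      fun a => by rw [wordEval_compWord]

theorem computablePred_components_eq_one (hn : Computable n) {x : ∀ i, Fin (n i) → G i}
    (h1 : ComputablePred fun a : ℕ × List (ℕ × Bool) => wordEval (extGen (x a.1)) a.2 = 1)
    {P : ℕ → Prop} (hP : ComputablePred P) :
    ComputablePred fun z => ∀ i, P i → (wordEval (sumGen x) z).1 i = 1 := by
  obtain ⟨I, hI, hI'⟩ := exists_summand_bound hn x
  refine (ComputablePred.forall_lt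
    (p := fun z i => P i → (wordEval (sumGen x) z).1 i = 1)
    ((hP.comp Computable.snd).imp (computablePred_component_eq_one hn h1))
    (hI.comp primrec_letterBound.to_comp)).of_eq fun z => ⟨fun h i hi => ?_, fun h i _ => h i⟩
  rcases lt_or_ge i (I (letterBound z)) with hlt | hge
  · exact h i hlt hi
  · exact wordEval_sumGen_apply_eq_one hI' z hge

theorem computablePred_sumGen_eq_one (hn : Computable n) {x : ∀ i, Fin (n i) → G i}
    (h1 : ComputablePred fun a : ℕ × List (ℕ × Bool) => wordEval (extGen (x a.1)) a.2 = 1) :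
    ComputablePred fun z => wordEval (sumGen x) z = 1 := by
  refine (computablePred_components_eq_one hn h1 (P := fun _ => True)
    (PrimrecPred.computablePred (PrimrecPred.of_eq (p := fun k : ℕ => k = k)
      (Primrec.eq.comp Primrec.id Primrec.id) (by simp)))).of_eq fun z => ?_
  rw [Subtype.ext_iff, funext_iff]
  simp

end DirectSum

/-! ### Deciding words in the groups of a recursively enumerated family -/

section Machines

open Nat.Partrec

/-- The subword of the letters with number less than `m`. -/
def restrictWord (m : ℕ) (l : List (ℕ × Bool)) : List (ℕ × Bool) :=
  l.filterMap fun p => if p.1 < m then some p else none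

theorem primrec_restrictWord : Primrec₂ restrictWord :=
  Primrec.listFilterMap Primrec.snd (Primrec.ite
    (Primrec.nat_lt.comp (Primrec.fst.comp Primrec.snd) (Primrec.fst.comp Primrec.fst))
    (Primrec.option_some.comp Primrec.snd) (Primrec.const none))

/-- A word in finitely many letters, as a word in letters that are indexed by `ℕ`. -/
def natWord {m : ℕ} (l : List (Fin m × Bool)) : List (ℕ × Bool) :=
  l.map fun p => ((p.1 : ℕ), p.2)

theorem encode_natWord {m : ℕ} (l : List (Fin m × Bool)) :
    Encodable.encode (natWord l) = Encodable.encode l := by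
  induction l with
  | nil => rfl
  | cons a l ih =>
    rw [natWord, List.map_cons, Encodable.encode_list_cons, Encodable.encode_list_cons,
      ← natWord, ih]
    rfl

theorem exists_natWord_eq_restrictWord (m : ℕ) (l : List (ℕ × Bool)) :
    ∃ l' : List (Fin m × Bool), natWord l' = restrictWord m l := by
  induction l with
  | nil => exact ⟨[], rfl⟩
  | cons a l ih =>
    obtain ⟨l', hl'⟩ := ih
    by_cases h : a.1 < m
    · exact ⟨(⟨a.1, h⟩, a.2) :: l', by simpa [natWord, restrictWord, h] using hl'⟩
    · exact ⟨l', by simpa [restrictWord, h] using hl'⟩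

theorem restrictWord_natWord {m : ℕ} (l : List (Fin m × Bool)) :
    restrictWord m (natWord l) = natWord l := by
  induction l with
  | nil => rfl
  | cons a l ih =>
    have := a.1.2
    simp only [restrictWord, natWord, List.map_cons, Fin.is_lt, if_true,
      List.filterMap_cons] at ih ⊢
    rw [ih]

variable {K : Type u} [Group K] {m : ℕ}

theorem wordEval_extGen_restrictWord (x : Fin m → K) (l : List (ℕ × Bool)) :
    wordEval (extGen x) (restrictWord m l) = wordEval (extGen x) l := by
  induction l with
  | nil => rfl
  | cons a l ih =>
    rw [wordEval_cons, ← ih]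
    by_cases h : a.1 < m
    · simp [restrictWord, h]
    · cases h2 : a.2 <;> simp [restrictWord, h, extGen]

theorem wordEval_extGen_natWord (x : Fin m → K) (l : List (Fin m × Bool)) :
    wordEval (extGen x) (natWord l) = wordEval x l := by
  rw [natWord, wordEval_map]
  congr 1
  funext j
  simp [extGen]

/-- Letters with a too large number stand for `1`, so that the restriction of a word to the letters
of `Fin m` represents the same element. -/
theorem exists_finWord (x : Fin m → K) (l : List (ℕ × Bool)) :
    ∃ l' : List (Fin m × Bool), natWord l' = restrictWord m l ∧
      wordEval x l' = wordEval (extGen x) l := by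
  obtain ⟨l', hl'⟩ := exists_natWord_eq_restrictWord m l
  refine ⟨l', hl', ?_⟩
  rw [← wordEval_extGen_natWord, hl', wordEval_extGen_restrictWord]

variable {G : ℕ → Type u} [∀ i, Group (G i)] {n : ℕ → ℕ} {x : ∀ i, Fin (n i) → G i}
  {ξ : ℕ → Code}

/-- Task `0` computes the numbers of generators. -/
theorem computable_generators (hξ : Computable ξ)
    (hP : ∀ i, ListsPresentation (ξ i) (x i)) : Computable n :=
  (Code.eval_part.comp hξ (Computable.const (Nat.pair 0 0))).of_eq_tot fun i => (hP i).generators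

theorem computablePred_of_solvesWordProblem (hξ : Computable ξ) (hn : Computable n)
    (hW : ∀ i, SolvesWordProblem (ξ i) (x i)) :
    ComputablePred fun a : ℕ × List (ℕ × Bool) => wordEval (extGen (x a.1)) a.2 = 1 := by
  classical
  have h1 : Computable fun a : ℕ × List (ℕ × Bool) =>
      if wordEval (extGen (x a.1)) a.2 = 1 then 1 else 0 := by
    refine (Code.eval_part.comp (hξ.comp Computable.fst)
      (Primrec₂.natPair.to_comp.comp (Computable.const 2) (Computable.encode.comp
        (primrec_restrictWord.to_comp.comp (hn.comp Computable.fst)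
          Computable.snd)))).of_eq_tot fun a => ?_
    obtain ⟨l', hl', hl''⟩ := exists_finWord (x a.1) a.2
    rw [← hl', encode_natWord, ← hl'']
    split_ifs with h
    · exact (hW a.1 l').1 h
    · exact (hW a.1 l').2 h
  refine ((PrimrecPred.computablePred (p := fun k : ℕ => k = 1)
    (Primrec.eq.comp Primrec.id (Primrec.const 1))).comp h1).of_eq fun a => ?_
  split_ifs with h <;> simp [h]

/-- Within `b.2` steps, the machine outputs the word `l` for the input `b.1` in the given task, and
`l` is a word in the letters with number less than `m`: outputs that encode other words are not part
of the list. -/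
def ListedAt (c : Code) (m task : ℕ) (b : ℕ × ℕ) (l : List (ℕ × Bool)) : Prop :=
  Code.evaln b.2 c (Nat.pair task b.1) = some (Encodable.encode l) ∧ restrictWord m l = l

theorem exists_listedAt_iff (c : Code) (m task : ℕ) (l : List (ℕ × Bool)) :
    (∃ b, ListedAt c m task b l) ↔
      ∃ l' : List (Fin m × Bool), Lists c task l' ∧ natWord l' = l := by
  constructor
  · rintro ⟨b, h1, h2⟩
    obtain ⟨l', hl'⟩ := exists_natWord_eq_restrictWord m l
    rw [h2] at hl'
    refine ⟨l', ⟨b.1, ?_⟩, hl'⟩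
    rw [← encode_natWord, hl']
    exact Code.evaln_sound h1
  · rintro ⟨l', ⟨k, hk⟩, rfl⟩
    obtain ⟨k', hk'⟩ := Code.evaln_complete.1 hk
    exact ⟨(k, k'), by rw [encode_natWord]; exact hk', restrictWord_natWord l'⟩

instance (c : Code) (m task : ℕ) (b : ℕ × ℕ) (l : List (ℕ × Bool)) :
    Decidable (ListedAt c m task b l) :=
  instDecidableAnd

theorem primrec_listedAt (task : ℕ) :
    PrimrecPred fun q : (Code × ℕ) × (List (ℕ × Bool) × (ℕ × ℕ)) =>
      ListedAt q.1.1 q.1.2 task q.2.2 q.2.1 := by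
  have hb : Primrec fun q : (Code × ℕ) × (List (ℕ × Bool) × (ℕ × ℕ)) => q.2.2 :=
    Primrec.snd.comp Primrec.snd
  have hl : Primrec fun q : (Code × ℕ) × (List (ℕ × Bool) × (ℕ × ℕ)) => q.2.1 :=
    Primrec.fst.comp Primrec.snd
  exact (Primrec.eq.comp (Code.primrec_evaln.comp (Primrec.pair (Primrec.pair
    (Primrec.snd.comp hb) (Primrec.fst.comp Primrec.fst))
    (Primrec₂.natPair.comp (Primrec.const task) (Primrec.fst.comp hb))))
    (Primrec.option_some.comp (Primrec.encode.comp hl))).and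
    (Primrec.eq.comp (primrec_restrictWord.comp (Primrec.snd.comp Primrec.fst) hl) hl)

/-- The conjugate of a relator or of its inverse that is described by `e`: here `e.1.1` is the
relator, which the machine has to list as described by `e.1.2`, the conjugator is `e.2.1`, and
`e.2.2` is the sign. The word is empty if `e.1.1` is not listed. -/
def relWord (c : Code × ℕ) (e : (List (ℕ × Bool) × (ℕ × ℕ)) × (List (ℕ × Bool) × Bool)) :
    List (ℕ × Bool) :=
  if ListedAt c.1 c.2 1 e.1.2 e.1.1 then
    e.2.1 ++ (cond e.2.2 e.1.1 (FreeGroup.invRev e.1.1) ++ FreeGroup.invRev e.2.1)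
  else []

theorem primrec_relWord : Primrec₂ relWord := by
  have hg : Primrec fun q : (Code × ℕ) × ((List (ℕ × Bool) × (ℕ × ℕ)) ×
      (List (ℕ × Bool) × Bool)) => q.2.2.1 := Primrec.fst.comp (Primrec.snd.comp Primrec.snd)
  have hl : Primrec fun q : (Code × ℕ) × ((List (ℕ × Bool) × (ℕ × ℕ)) ×
      (List (ℕ × Bool) × Bool)) => q.2.1.1 := Primrec.fst.comp (Primrec.fst.comp Primrec.snd)
  refine Primrec.ite ((primrec_listedAt 1).comp (Primrec.pair Primrec.fst
    (Primrec.fst.comp Primrec.snd))) ?_ (Primrec.const [])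
  exact Primrec.list_append.comp hg (Primrec.list_append.comp
    (Primrec.cond (Primrec.snd.comp (Primrec.snd.comp Primrec.snd)) hl (primrec_invRev.comp hl))
    (primrec_invRev.comp hg))

/-- The product of the conjugates of relators that are described by the entries of a list. -/
def relProd (c : Code × ℕ)
    (W : List ((List (ℕ × Bool) × (ℕ × ℕ)) × (List (ℕ × Bool) × Bool))) : List (ℕ × Bool) :=
  W.flatMap (relWord c)

theorem primrec_relProd : Primrec₂ relProd :=
  Primrec.list_flatMap Primrec.snd (primrec_relWord.comp (Primrec.fst.comp Primrec.fst)
    Primrec.snd)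

/-- The inverse of a product of conjugates of relators is obtained by reversing the list and the
signs. -/
theorem exists_relProd_inv (c : Code × ℕ)
    (W : List ((List (ℕ × Bool) × (ℕ × ℕ)) × (List (ℕ × Bool) × Bool))) :
    ∃ W', FreeGroup.mk (relProd c W') = (FreeGroup.mk (relProd c W))⁻¹ := by
  induction W with
  | nil => exact ⟨[], rfl⟩
  | cons e W ih =>
    obtain ⟨W', hW'⟩ := ih
    refine ⟨W' ++ [(e.1, (e.2.1, !e.2.2))], ?_⟩
    have h1 : FreeGroup.mk (relWord c (e.1, (e.2.1, !e.2.2))) =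
        (FreeGroup.mk (relWord c e))⁻¹ := by
      rw [FreeGroup.inv_mk]
      unfold relWord
      split_ifs
      · cases e.2.2 <;> simp [List.append_assoc]
      · rfl
    have h2 : ∀ U V, FreeGroup.mk (relProd c (U ++ V)) =
        FreeGroup.mk (relProd c U) * FreeGroup.mk (relProd c V) := fun U V => by
      simp [relProd]
    have h3 : ∀ e, relProd c [e] = relWord c e := fun e => by simp [relProd]
    rw [h2, hW', h3, h1, ← mul_inv_rev, ← h3 e, ← h2]
    rfl

theorem wordEval_relProd {c : Code} {x : Fin m → K} (hP : ListsPresentation c x)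
    (W : List ((List (ℕ × Bool) × (ℕ × ℕ)) × (List (ℕ × Bool) × Bool))) :
    wordEval (extGen x) (relProd (c, m) W) = 1 := by
  induction W with
  | nil => rfl
  | cons e W ih =>
    have h0 : relProd (c, m) (e :: W) = relWord (c, m) e ++ relProd (c, m) W := rfl
    rw [h0, wordEval_append, ih, mul_one, relWord]
    split_ifs with h
    · obtain ⟨l', hl', hl''⟩ := (exists_listedAt_iff c m 1 e.1.1).1 ⟨_, h⟩
      have h1 : FreeGroup.mk l' ∈ (FreeGroup.lift x).ker := by
        rw [← hP.relators]
        exact Subgroup.subset_normalClosure ⟨l', hl', rfl⟩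
      have h2 : wordEval (extGen x) e.1.1 = 1 := by
        rw [← hl'', wordEval_extGen_natWord]
        exact h1
      rw [wordEval_append, wordEval_append, wordEval_invRev]
      cases e.2.2 <;> simp [wordEval_invRev, h2]
    · rfl

/-- Every element of the normal closure of the listed relators is a product of conjugates of listed
relators and their inverses. -/
theorem exists_relProd_eq {c : Code} {g : FreeGroup (Fin m)}
    (hg : g ∈ Subgroup.normalClosure
      {g : FreeGroup (Fin m) | ∃ l : List (Fin m × Bool), Lists c 1 l ∧ g = FreeGroup.mk l}) :
    ∃ W, FreeGroup.mk (relProd (c, m) W) = FreeGroup.map (fun j : Fin m => (j : ℕ)) g := by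
  rw [Subgroup.normalClosure] at hg
  induction hg using Subgroup.closure_induction with
  | mem g hg =>
    obtain ⟨_, ⟨l, hl, rfl⟩, hconj⟩ := Group.mem_conjugatesOfSet_iff.1 hg
    obtain ⟨d, rfl⟩ := isConj_iff.1 hconj
    obtain ⟨b, hb⟩ := (exists_listedAt_iff c m 1 (natWord l)).2 ⟨l, hl, rfl⟩
    obtain ⟨d, rfl⟩ : ∃ d', FreeGroup.mk d' = d := ⟨d.toWord, FreeGroup.mk_toWord⟩
    refine ⟨[((natWord l, b), (natWord d, true))], ?_⟩
    have h1 : relProd (c, m) [((natWord l, b), (natWord d, true))] =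
        natWord d ++ (natWord l ++ FreeGroup.invRev (natWord d)) := by
      simp [relProd, relWord, hb]
    rw [h1, map_mul, map_mul, map_inv, FreeGroup.map.mk, FreeGroup.map.mk,
      ← FreeGroup.mul_mk, ← FreeGroup.mul_mk, ← FreeGroup.inv_mk, mul_assoc]
    rfl
  | one => exact ⟨[], by simp [relProd, FreeGroup.one_eq_mk]⟩
  | mul a b _ _ ha hb =>
    obtain ⟨U, hU⟩ := ha
    obtain ⟨V, hV⟩ := hb
    exact ⟨U ++ V, by rw [map_mul, ← hU, ← hV]; simp [relProd]⟩
  | inv a _ ha =>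
    obtain ⟨U, hU⟩ := ha
    obtain ⟨V, hV⟩ := exists_relProd_inv (c, m) U
    exact ⟨V, by rw [hV, hU, map_inv]⟩

/-- A word represents the identity if and only if it is freely equal to a product of conjugates of
listed relators and their inverses. -/
theorem wordEval_extGen_eq_one_iff {c : Code} {x : Fin m → K} (hP : ListsPresentation c x)
    (l : List (ℕ × Bool)) : wordEval (extGen x) l = 1 ↔
      ∃ W, FreeGroup.reduce (restrictWord m l) = FreeGroup.reduce (relProd (c, m) W) := by
  constructor
  · intro h
    obtain ⟨l', hl', hl''⟩ := exists_finWord x l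
    have h1 : FreeGroup.mk l' ∈ (FreeGroup.lift x).ker := hl''.trans h
    rw [← hP.relators] at h1
    obtain ⟨W, hW⟩ := exists_relProd_eq h1
    refine ⟨W, FreeGroup.reduce.sound ?_⟩
    rw [hW, ← hl']
    rfl
  · rintro ⟨W, hW⟩
    rw [← wordEval_extGen_restrictWord, wordEval_eq_lift, FreeGroup.reduce.exact hW,
      ← wordEval_eq_lift, wordEval_relProd hP]

theorem rePred_extGen_eq_one (hξ : Computable ξ) (hn : Computable n)
    (hP : ∀ i, ListsPresentation (ξ i) (x i)) :
    REPred fun a : ℕ × List (ℕ × Bool) => wordEval (extGen (x a.1)) a.2 = 1 := by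
  refine (ComputablePred.re_exists (p := fun (a : ℕ × List (ℕ × Bool)) W =>
    FreeGroup.reduce (restrictWord (n a.1) a.2) =
      FreeGroup.reduce (relProd (ξ a.1, n a.1) W)) ?_).of_eq
    fun a => (wordEval_extGen_eq_one_iff (hP a.1) a.2).symm
  refine (PrimrecPred.computablePred (p := fun q : List (ℕ × Bool) × List (ℕ × Bool) => q.1 = q.2)
    Primrec.eq).comp (Computable.pair ?_ ?_)
  · exact primrec_reduce.to_comp.comp (primrec_restrictWord.to_comp.comp
      (hn.comp (Computable.fst.comp Computable.fst)) (Computable.snd.comp Computable.fst))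
  · exact primrec_reduce.to_comp.comp (primrec_relProd.to_comp.comp (Computable.pair
      (hξ.comp (Computable.fst.comp Computable.fst))
      (hn.comp (Computable.fst.comp Computable.fst))) Computable.snd)

end Machines

/-! ### Left-orders and positive cones -/

section Cones

variable {H : Type w} [Group H]

/-- `P` is the positive cone of a left-order. -/
structure IsPosCone (P : H → Prop) : Prop where
  not_one : ¬ P 1
  mul : ∀ a b, P a → P b → P (a * b)
  total : ∀ a, a ≠ 1 → P a ∨ P a⁻¹

theorem IsPosCone.not_iff {P : H → Prop} (hP : IsPosCone P) (a : H) :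
    ¬ P a ↔ a = 1 ∨ P a⁻¹ := by
  constructor
  · intro h
    by_cases h1 : a = 1
    · exact Or.inl h1
    · exact Or.inr ((hP.total a h1).resolve_left h)
  · rintro (rfl | h) h'
    · exact hP.not_one h'
    · exact hP.not_one (by simpa using hP.mul _ _ h' h)

theorem IsPosCone.eq_one_iff {P : H → Prop} (hP : IsPosCone P) (a : H) :
    a = 1 ↔ ¬ P a ∧ ¬ P a⁻¹ := by
  constructor
  · rintro rfl
    simp [hP.not_one]
  · rintro ⟨h1, h2⟩
    by_contra h
    exact (hP.total a h).elim h1 h2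

theorem IsPosCone.isLeftOrder {P : H → Prop} (hP : IsPosCone P) :
    IsLeftOrder fun a b => P (a⁻¹ * b) where
  irrefl a := by simpa using hP.not_one
  trans a b c hab hbc := by simpa [mul_assoc] using hP.mul _ _ hab hbc
  total a b := by
    by_cases h : a = b
    · exact Or.inr (Or.inl h)
    · rcases hP.total (a⁻¹ * b) (by rwa [Ne, inv_mul_eq_one]) with h1 | h1
      · exact Or.inl h1
      · exact Or.inr (Or.inr (by simpa using h1))
  mul_left a b c h := by simpa [mul_assoc] using h

theorem IsLeftOrder.isPosCone {r : H → H → Prop} (hr : IsLeftOrder r) :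
    IsPosCone fun a => r 1 a where
  not_one := hr.irrefl 1
  mul a b ha hb := hr.trans _ _ _ ha (by simpa using hr.mul_left _ _ a hb)
  total a ha := by
    rcases hr.total 1 a with h | h | h
    · exact Or.inl h
    · exact absurd h.symm ha
    · exact Or.inr (by simpa using hr.mul_left _ _ a⁻¹ h)

theorem IsPosCone.comap {K : Type*} [Group K] {P : K → Prop} (hP : IsPosCone P) (φ : H →* K)
    (hφ : Function.Injective φ) : IsPosCone fun a => P (φ a) where
  not_one := by simpa using hP.not_one
  mul a b ha hb := by simpa using hP.mul _ _ ha hb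
  total a ha := by
    simpa using hP.total (φ a) (by rwa [Ne, map_eq_one_iff φ hφ])

/-- The lexicographic cone for a sequence of homomorphisms: an element is positive if its first
non-trivial image is positive. -/
def lexCone {K : ℕ → Type u} [∀ k, Group (K k)] (π : ∀ k, H →* K k) (P : ∀ k, K k → Prop)
    (a : H) : Prop :=
  ∃ k, (∀ k' < k, π k' a = 1) ∧ P k (π k a)

theorem isPosCone_lexCone {K : ℕ → Type u} [∀ k, Group (K k)] {π : ∀ k, H →* K k}
    (hπ : ∀ a, (∀ k, π k a = 1) → a = 1) {P : ∀ k, K k → Prop} (hP : ∀ k, IsPosCone (P k)) :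
    IsPosCone (lexCone π P) where
  not_one := by
    rintro ⟨k, -, h⟩
    exact (hP k).not_one (by simpa using h)
  mul := by
    rintro a b ⟨k, hk, ha⟩ ⟨l, hl, hb⟩
    rcases lt_trichotomy k l with h | rfl | h
    · exact ⟨k, fun i hi => by rw [map_mul, hk i hi, hl i (hi.trans h), mul_one],
        by rwa [map_mul, hl k h, mul_one]⟩
    · exact ⟨k, fun i hi => by rw [map_mul, hk i hi, hl i hi, mul_one],
        by rw [map_mul]; exact (hP k).mul _ _ ha hb⟩
    · exact ⟨l, fun i hi => by rw [map_mul, hk i (hi.trans h), hl i hi, mul_one],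
        by rwa [map_mul, hk l h, one_mul]⟩
  total a ha := by
    classical
    have hex : ∃ k, π k a ≠ 1 := by
      by_contra h
      push Not at h
      exact ha (hπ a h)
    have hlt : ∀ k < Nat.find hex, π k a = 1 := fun k hk => not_not.1 (Nat.find_min hex hk)
    rcases (hP _).total _ (Nat.find_spec hex) with h | h
    · exact Or.inl ⟨_, hlt, h⟩
    · exact Or.inr ⟨_, fun k hk => by rw [map_inv, hlt k hk, inv_one], by rwa [map_inv]⟩

/-- The lexicographic cone of the group of functions on the infinite cyclic group, along the
enumeration `enumPos`; the repetitions in the enumeration do not matter. -/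
def funCone {K : Type u} [Group K] (P : K → Prop) : (Multiplicative ℤ → K) → Prop :=
  lexCone (fun k => Pi.evalMonoidHom (fun _ : Multiplicative ℤ => K) (enumPos k)) fun _ => P

theorem isPosCone_funCone {K : Type u} [Group K] {P : K → Prop} (hP : IsPosCone P) :
    IsPosCone (funCone P) := by
  refine isPosCone_lexCone (fun f hf => ?_) fun _ => hP
  funext q
  obtain ⟨k, rfl, -⟩ := exists_enumPos_eq q
  exact hf k

/-- The cone of the wreath product: the exponent of the cyclic generator decides, and if it is `0`,
then the function part does. -/
def wreathCone {K : Type u} [Group K] (P : K → Prop) (g : Wreath K) : Prop :=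
  0 < g.right.toAdd ∨ g.right = 1 ∧ funCone P g.left

theorem isPosCone_wreathCone {K : Type u} [Group K] {P : K → Prop} (hP : IsPosCone P) :
    IsPosCone (wreathCone P) where
  not_one := by
    rintro (h | ⟨-, h⟩)
    · simp at h
    · exact (isPosCone_funCone hP).not_one h
  mul := by
    rintro a b (ha | ⟨ha, ha'⟩) (hb | ⟨hb, hb'⟩)
    · exact Or.inl (by simpa using add_pos ha hb)
    · exact Or.inl (by simpa [hb] using ha)
    · exact Or.inl (by simpa [ha] using hb)
    · refine Or.inr ⟨by simp [ha, hb], ?_⟩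
      have h : (a * b).left = a.left * b.left := by simp [ha]
      rw [h]
      exact (isPosCone_funCone hP).mul _ _ ha' hb'
  total a ha := by
    rcases lt_trichotomy 0 a.right.toAdd with h | h | h
    · exact Or.inl (Or.inl h)
    · have h1 : a.right = 1 := Multiplicative.toAdd.injective h.symm
      have h2 : a.left ≠ 1 := fun h2 => ha (SemidirectProduct.ext h2 h1)
      have h3 : a⁻¹.left = a.left⁻¹ := by simp [h1]
      rcases (isPosCone_funCone hP).total _ h2 with h4 | h4
      · exact Or.inl (Or.inr ⟨h1, h4⟩)
      · exact Or.inr (Or.inr ⟨by simp [h1], by rwa [h3]⟩)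
    · exact Or.inr (Or.inl (by simpa using h))

theorem wreathCone_iff {K : Type u} [Group K] (P : K → Prop) (g : Wreath K) :
    wreathCone P g ↔ 0 < g.right.toAdd ∨
      ∃ k, (∀ k' < k, g.left (enumPos k') = 1) ∧ g.right = 1 ∧ P (g.left (enumPos k)) := by
  refine or_congr_right ⟨?_, ?_⟩
  · rintro ⟨h1, k, hk, hk'⟩
    exact ⟨k, hk, h1, hk'⟩
  · rintro ⟨k, hk, h1, hk'⟩
    exact ⟨h1, k, hk, hk'⟩

end Cones

/-! ### Deciding signs -/

section Signs

theorem computablePred_false {α : Type} [Primcodable α] : ComputablePred fun _ : α => False :=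
  ⟨fun _ => instDecidableFalse, Computable.const false⟩

variable {K : Type u} [Group K] {y : ℕ → K} {Fs : Multiplicative ℤ → Wreath K} {P : K → Prop}

theorem computablePred_wreathCone_step (hO : ComputablePred fun z => wordEval y z = 1)
    (hP : IsPosCone P) (hp : ComputablePred fun z => P (wordEval y z)) :
    ComputablePred fun v => wreathCone P (wordEval (stepGen y) v) := by
  refine ComputablePred.of_lex
    (o := fun v k => (wordEval (stepGen y) v).left (enumPos k) = 1)
    (p := fun v k => (wordEval (stepGen y) v).right = 1 ∧
      P ((wordEval (stepGen y) v).left (enumPos k)))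
    (inv := FreeGroup.invRev)
    (computablePred_step_eq_one hO) (computablePred_stepWord_eq_one hO) ?_
    ((computablePred_pos_comp_pos (primrec_expo primrec_stepCoord)).of_eq
      fun v => by rw [pos_expo_step y])
    primrec_invRev.to_comp (fun v => wreathCone_iff P _) fun v => ?_
  · exact ((computablePred_step_right_eq_one y).comp Computable.fst).and
      ((hp.comp primrec_stepWord.to_comp).of_eq fun a => by rw [wordEval_stepWord])
  · rw [wordEval_invRev]
    exact (isPosCone_wreathCone hP).not_iff _

theorem IsSparse.computablePred_eq_one (hO : ComputablePred fun z => wordEval y z = 1)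
    (hF : IsSparse y Fs) : ComputablePred fun w => wordEval (pairGen Fs) w = 1 := by
  have h1 := (primrec_sparseWord.comp Primrec.id (Primrec.const (Nat.pair 1 0))).to_comp
  refine ((hF.computablePred_isDelta hO).and ((computablePred_stepWord_eq_one hO).comp
    (Computable.pair h1 (Computable.const 0)))).of_eq fun w => ?_
  rw [hF.wordEval_sparseWord, id, enumPos_pair_one_zero, enumPos_zero]
  constructor
  · rintro ⟨⟨h2, h3⟩, h4⟩
    rw [h2.eq_base, h3.eq_base, h4, Pi.mulSingle_one]
    exact congrArg base (Pi.mulSingle_one _)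
  · intro h
    simp [h, IsDelta]

theorem IsSparse.computablePred_wreathCone (hO : ComputablePred fun z => wordEval y z = 1)
    (hP : IsPosCone P) (hp : ComputablePred fun z => P (wordEval y z)) (hF : IsSparse y Fs) :
    ComputablePred fun w => wreathCone (wreathCone P) (wordEval (pairGen Fs) w) := by
  refine ComputablePred.of_lex
    (o := fun w k => (wordEval (pairGen Fs) w).left (enumPos k) = 1)
    (p := fun w k => (wordEval (pairGen Fs) w).right = 1 ∧
      wreathCone P ((wordEval (pairGen Fs) w).left (enumPos k)))
    (inv := FreeGroup.invRev)
    (hF.computablePred_eq_one hO) (hF.computablePred_sparseWord_eq_one hO) ?_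
    ((computablePred_pos_comp_pos (primrec_expo primrec_sparseCoord)).of_eq
      fun w => by rw [hF.pos_expo_sparse])
    primrec_invRev.to_comp (fun w => wreathCone_iff _ _) fun w => ?_
  · exact (hF.computablePred_right_eq_one.comp Computable.fst).and
      (((computablePred_wreathCone_step hO hP hp).comp primrec_sparseWord.to_comp).of_eq
        fun a => by rw [hF.wordEval_sparseWord])
  · rw [wordEval_invRev]
    exact (isPosCone_wreathCone (isPosCone_wreathCone hP)).not_iff _

variable {G : ℕ → Type u} [∀ i, Group (G i)] {n : ℕ → ℕ} {x : ∀ i, Fin (n i) → G i}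

/-- The lexicographic cone of the direct sum. -/
def sumCone {G : ℕ → Type u} [∀ i, Group (G i)] (Q : ∀ i, G i → Prop) : directSum G → Prop :=
  lexCone (fun i => (Pi.evalMonoidHom G i).comp (directSum G).subtype) Q

theorem isPosCone_sumCone {Q : ∀ i, G i → Prop} (hQ : ∀ i, IsPosCone (Q i)) :
    IsPosCone (sumCone Q) :=
  isPosCone_lexCone (fun _ ha => Subtype.ext (funext ha)) hQ

theorem computablePred_sumCone (hn : Computable n) {Q : ∀ i, G i → Prop}
    (hQ : ∀ i, IsPosCone (Q i))
    (h1 : ComputablePred fun a : ℕ × List (ℕ × Bool) => wordEval (extGen (x a.1)) a.2 = 1)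
    (hp : ComputablePred fun a : ℕ × List (ℕ × Bool) => Q a.1 (wordEval (extGen (x a.1)) a.2)) :
    ComputablePred fun z => sumCone Q (wordEval (sumGen x) z) := by
  refine ComputablePred.of_lex
    (o := fun z i => (wordEval (sumGen x) z).1 i = 1)
    (p := fun z i => Q i ((wordEval (sumGen x) z).1 i))
    (inv := FreeGroup.invRev)
    (computablePred_sumGen_eq_one hn h1) (computablePred_component_eq_one hn h1) ?_
    computablePred_false primrec_invRev.to_comp (fun z => by rw [false_or]; rfl) fun z => ?_
  · exact (hp.comp (Computable.pair Computable.snd (primrec_compWord.to_comp.comp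
      ((computable_numGens hn).comp Computable.snd) Computable.fst))).of_eq
        fun a => by rw [wordEval_compWord]
  · rw [wordEval_invRev]
    exact (isPosCone_sumCone hQ).not_iff _

open Nat.Partrec

variable {ξ : ℕ → Code} {r : ∀ i, G i → G i → Prop}

/-- A word is positive if and only if it equals a listed positive word, that is, if the quotient of
the two words is freely equal to a product of conjugates of relators. -/
theorem rePred_extGen_pos (hξ : Computable ξ) (hn : Computable n)
    (hP : ∀ i, ListsPresentation (ξ i) (x i)) (hC : ∀ i, ListsPositiveCone (ξ i) (x i) (r i)) :
    REPred fun a : ℕ × List (ℕ × Bool) => r a.1 1 (wordEval (extGen (x a.1)) a.2) := by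
  have hc : Computable fun q : (ℕ × List (ℕ × Bool)) × ((List (ℕ × Bool) × (ℕ × ℕ)) ×
      List ((List (ℕ × Bool) × (ℕ × ℕ)) × (List (ℕ × Bool) × Bool))) => (ξ q.1.1, n q.1.1) :=
    Computable.pair (hξ.comp (Computable.fst.comp Computable.fst))
      (hn.comp (Computable.fst.comp Computable.fst))
  refine (ComputablePred.re_exists (p := fun (a : ℕ × List (ℕ × Bool))
    (b : (List (ℕ × Bool) × (ℕ × ℕ)) ×
      List ((List (ℕ × Bool) × (ℕ × ℕ)) × (List (ℕ × Bool) × Bool))) =>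
    ListedAt (ξ a.1) (n a.1) 3 b.1.2 b.1.1 ∧
      FreeGroup.reduce (restrictWord (n a.1) (FreeGroup.invRev b.1.1 ++ a.2)) =
      FreeGroup.reduce (relProd (ξ a.1, n a.1) b.2)) ?_).of_eq fun a => ?_
  · refine ((primrec_listedAt 3).computablePred.comp
      (Computable.pair hc (Computable.fst.comp Computable.snd))).and ?_
    refine (PrimrecPred.computablePred
      (p := fun q : List (ℕ × Bool) × List (ℕ × Bool) => q.1 = q.2) Primrec.eq).comp
      (Computable.pair ?_ ?_)
    · exact primrec_reduce.to_comp.comp (primrec_restrictWord.to_comp.comp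
        (Computable.snd.comp hc) (Primrec.list_append.to_comp.comp (primrec_invRev.to_comp.comp
          (Computable.fst.comp (Computable.fst.comp Computable.snd)))
          (Computable.snd.comp Computable.fst)))
    · exact primrec_reduce.to_comp.comp (primrec_relProd.to_comp.comp hc
        (Computable.snd.comp Computable.snd))
  · have key : r a.1 1 (wordEval (extGen (x a.1)) a.2) ↔ ∃ l : List (Fin (n a.1) × Bool),
        Lists (ξ a.1) 3 l ∧ wordEval (x a.1) l = wordEval (extGen (x a.1)) a.2 :=
      Set.ext_iff.1 (hC a.1) _
    rw [key]
    constructor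
    · rintro ⟨⟨⟨l, b⟩, W⟩, hl, hW⟩
      obtain ⟨l', hl', hl''⟩ := (exists_listedAt_iff _ _ 3 l).1 ⟨b, hl⟩
      have h1 := (wordEval_extGen_eq_one_iff (hP a.1) _).2 ⟨W, hW⟩
      rw [wordEval_append, wordEval_invRev, inv_mul_eq_one] at h1
      exact ⟨l', hl', by rw [← h1, ← hl'', wordEval_extGen_natWord]⟩
    · rintro ⟨l, hl, hl'⟩
      obtain ⟨b, hb⟩ := (exists_listedAt_iff _ _ 3 (natWord l)).2 ⟨l, hl, rfl⟩
      obtain ⟨W, hW⟩ := (wordEval_extGen_eq_one_iff (hP a.1)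
        (FreeGroup.invRev (natWord l) ++ a.2)).1 (by
          rw [wordEval_append, wordEval_invRev, wordEval_extGen_natWord, hl', inv_mul_cancel])
      exact ⟨((natWord l, b), W), hb, hW⟩

/-- The order of `G i` is decidable uniformly in `i`: being positive, being negative and being
trivial are recursively enumerable, and exactly one of them holds. -/
theorem computablePred_extGen_pos (hξ : Computable ξ) (hn : Computable n)
    (hP : ∀ i, ListsPresentation (ξ i) (x i)) (hC : ∀ i, ListsPositiveCone (ξ i) (x i) (r i))
    (hr : ∀ i, IsLeftOrder (r i)) :
    ComputablePred fun a : ℕ × List (ℕ × Bool) => r a.1 1 (wordEval (extGen (x a.1)) a.2) := by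
  refine ComputablePred.computable_iff_re_compl_re'.2 ⟨rePred_extGen_pos hξ hn hP hC, ?_⟩
  refine ((rePred_extGen_eq_one hξ hn hP).or ((rePred_extGen_pos hξ hn hP hC).comp
    (Computable.pair Computable.fst (primrec_invRev.to_comp.comp Computable.snd)))).of_eq
    fun a => ?_
  rw [wordEval_invRev]
  exact ((hr a.1).isPosCone.not_iff _).symm

theorem computablePred_extGen_eq_one_of_pos (hr : ∀ i, IsLeftOrder (r i))
    (h : ComputablePred fun a : ℕ × List (ℕ × Bool) =>
      r a.1 1 (wordEval (extGen (x a.1)) a.2)) :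
    ComputablePred fun a : ℕ × List (ℕ × Bool) => wordEval (extGen (x a.1)) a.2 = 1 :=
  (h.not.and (h.comp (Computable.pair Computable.fst
    (primrec_invRev.to_comp.comp Computable.snd))).not).of_eq fun a => by
      rw [wordEval_invRev]
      exact ((hr a.1).isPosCone.eq_one_iff _).symm

end Signs

/-! ### The embedding -/

section Embedding

/-- The embedding of `K` into the double wreath product: the element `a` is sent to the function
that is supported at `s`, with the value that is supported at `1` and has value `a` there. -/
def deltaHom (K : Type u) [Group K] : K →* Wreath (Wreath K) :=
  (SemidirectProduct.inl.comp
    (MonoidHom.mulSingle (fun _ : Multiplicative ℤ => Wreath K) (Multiplicative.ofAdd 1))).comp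
    (SemidirectProduct.inl.comp (MonoidHom.mulSingle (fun _ : Multiplicative ℤ => K) 1))

variable {K : Type u} [Group K] {y : ℕ → K} {Fs : Multiplicative ℤ → Wreath K}

theorem deltaHom_apply (a : K) : deltaHom K a =
    base (Pi.mulSingle (Multiplicative.ofAdd 1) (base (Pi.mulSingle 1 a))) :=
  rfl

theorem deltaHom_left_left (a : K) :
    ((deltaHom K a).left (Multiplicative.ofAdd 1)).left 1 = a := by
  simp [deltaHom_apply]

theorem deltaHom_injective : Function.Injective (deltaHom K) := fun a b h => by
  rw [← deltaHom_left_left a, h, deltaHom_left_left]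

theorem isDelta_deltaHom (a : K) : IsDelta (deltaHom K a) (Multiplicative.ofAdd 1) ∧
    IsDelta ((deltaHom K a).left (Multiplicative.ofAdd 1)) 1 := by
  rw [deltaHom_apply]
  refine ⟨isDelta_base_mulSingle _ _, ?_⟩
  rw [base_left, Pi.mulSingle_eq_same]
  exact isDelta_base_mulSingle _ _

theorem eq_deltaHom {g : Wreath (Wreath K)} (h : IsDelta g (Multiplicative.ofAdd 1) ∧
    IsDelta (g.left (Multiplicative.ofAdd 1)) 1) :
    g = deltaHom K ((g.left (Multiplicative.ofAdd 1)).left 1) := by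
  rw [deltaHom_apply, ← h.2.eq_base, ← h.1.eq_base]

theorem cyc_pow_conj_base (k : ℕ) (f : Multiplicative ℤ → K) :
    cyc K ^ k * base f * (cyc K ^ k)⁻¹ = base fun q => f (q * Multiplicative.ofAdd (k : ℤ)) := by
  have h : cyc K ^ k = SemidirectProduct.inr (Multiplicative.ofAdd (k : ℤ)) := by
    rw [cyc, ← map_pow, ← ofAdd_nsmul, nsmul_one]
  rw [h, base, ← map_inv, ← SemidirectProduct.inl_aut]
  rfl

open scoped commutatorElement

theorem commutator_base (f g : Multiplicative ℤ → K) :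
    ⁅base f, base g⁆ = base fun q => ⁅f q, g q⁆ :=
  (map_commutatorElement SemidirectProduct.inl f g).symm

theorem commutator_cyc_stepFun (a : K) :
    ⁅cyc K, base (stepFun a)⁆ = base (Pi.mulSingle 1 a) := by
  have h := cyc_pow_conj_base (K := K) 1 (stepFun a)
  rw [pow_one] at h
  rw [commutatorElement_def, h, base_inv]
  change SemidirectProduct.inl _ * SemidirectProduct.inl _ = SemidirectProduct.inl _
  rw [← map_mul]
  congr 1
  funext q
  by_cases h0 : q = 1
  · subst h0
    simp [stepFun]
  · have h1 : q.toAdd ≠ 0 := by simpa using h0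
    rw [Pi.mulSingle_eq_of_ne h0]
    have h2 : 0 < q.toAdd + 1 ↔ 0 < q.toAdd := by omega
    simp only [Pi.mul_apply, Pi.inv_apply, stepFun, toAdd_mul, toAdd_ofAdd, Nat.cast_one, h2]
    exact mul_inv_cancel _

/-- The powers of `2` other than `1` are even, so that `1` is the only power of `2` which differs
from another power of `2` by `2 ^ m - 1`. Hence the commutator is supported at `s`. -/
theorem IsSparse.commutator_eq (hF : IsSparse y Fs) {m : ℕ} (hm : m ≠ 0) :
    ⁅base Fs, cyc (Wreath K) ^ (2 ^ m - 1) * base Fs * (cyc (Wreath K) ^ (2 ^ m - 1))⁻¹⁆ =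
      deltaHom K (y m) := by
  rw [cyc_pow_conj_base, commutator_base, deltaHom_apply]
  congr 1
  funext q
  have hcast : ((2 ^ m - 1 : ℕ) : ℤ) = 2 ^ m - 1 := by
    have := Nat.one_le_two_pow (n := m)
    push_cast [this]
    rfl
  rw [hcast]
  obtain ⟨q, rfl⟩ := Multiplicative.ofAdd.surjective q
  rw [← ofAdd_add]
  by_cases hq : q = 1
  · subst hq
    rw [Pi.mulSingle_eq_same, hF.one, add_sub_cancel, hF.two_pow, stepGen_of_ne y hm,
      commutator_cyc_stepFun]
  · rw [Pi.mulSingle_eq_of_ne (by simpa using hq)]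
    by_cases h1 : ∃ l : ℕ, q = 2 ^ l
    · obtain ⟨l, rfl⟩ := h1
      rw [hF.other (2 ^ l + (2 ^ m - 1)), commutatorElement_one_right]
      intro k hk
      have hl : l ≠ 0 := by rintro rfl; simp at hq
      obtain ⟨l, rfl⟩ := Nat.exists_eq_succ_of_ne_zero hl
      obtain ⟨m, rfl⟩ := Nat.exists_eq_succ_of_ne_zero hm
      have hl' : (0 : ℤ) < 2 ^ l := by positivity
      have hm' : (0 : ℤ) < 2 ^ m := by positivity
      rw [Nat.succ_eq_add_one, Nat.succ_eq_add_one, pow_succ, pow_succ] at hk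
      -- If `k = 0`, then the right side is too small; otherwise the two sides differ in parity.
      cases k with
      | zero => rw [pow_zero] at hk; omega
      | succ k => rw [pow_succ] at hk; omega
    · rw [hF.other q (by simpa using h1), commutatorElement_one_left]

end Embedding

/-! ### The subgroup `H̃` -/

section Htilde

variable {G : ℕ → Type u} [∀ i, Group (G i)] {n : ℕ → ℕ}

theorem isSparse_bigFun (x : ∀ i, Fin (n i) → G i) : IsSparse (sumGen x) (bigFun x) where
  two_pow m := by
    by_cases hm : m = 0
    · subst hm
      simp [bigFun]
    · by_cases h : ∃ p : Σ i, Fin (n i), m = genIndex n p.1 p.2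
      · obtain ⟨⟨i, j⟩, rfl⟩ := h
        rw [bigFun_two_pow, stepGen_of_ne _ hm, sumGen_genIndex]
      · have h1 : ((2 : ℤ) ^ m) ≠ 1 := (one_lt_pow₀ (by norm_num) hm).ne'
        have h2 : ¬ ∃ p : Σ i, Fin (n i), (2 : ℤ) ^ m = 2 ^ genIndex n p.1 p.2 := by
          rintro ⟨p, hp⟩
          exact h ⟨p, Int.pow_right_injective (by norm_num : 1 < (2 : ℤ).natAbs) hp⟩
        have h3 : stepFun (1 : directSum G) = 1 := by
          funext q
          simp [stepFun]
        rw [bigFun, toAdd_ofAdd, if_neg h1, dif_neg h2, stepGen_of_ne _ hm, sumGen, dif_neg h, h3]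
        rfl
  other q hq := by
    rw [bigFun, toAdd_ofAdd, if_neg (by simpa using hq 0), dif_neg]
    rintro ⟨p, hp⟩
    exact hq _ hp

theorem coe_wordEval_HtildeGen (x : ∀ i, Fin (n i) → G i) (w : List (Fin 2 × Bool)) :
    ((wordEval (HtildeGen x) w : Htilde x) : Wreath (Wreath (directSum G))) =
      wordEval (pairGen (bigFun x)) w := by
  rw [← Subgroup.coe_subtype, map_wordEval]
  congr 1
  funext b
  fin_cases b <;> rfl

theorem PsiGen_eq_deltaHom (x : ∀ i, Fin (n i) → G i) (i : ℕ) (j : Fin (n i)) :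
    PsiGen x i j = deltaHom (directSum G) (incl G i (x i j)) := by
  rw [← sumGen_genIndex, ← (isSparse_bigFun x).commutator_eq (by simp [genIndex])]
  rfl

theorem mem_of_forall_incl_mem (S : Subgroup (directSum G)) (hS : ∀ i a, incl G i a ∈ S)
    (a : directSum G) : a ∈ S := by
  have key : ∀ (s : Finset ℕ) (a : directSum G), (∀ i ∉ s, a.1 i = 1) → a ∈ S := by
    intro s
    induction s using Finset.induction with
    | empty =>
      intro a ha
      rw [show a = 1 from Subtype.ext (funext fun i => ha i (Finset.notMem_empty i))]
      exact S.one_mem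
    | insert k s hk ih =>
      intro a ha
      rw [← mul_inv_cancel_left (incl G k (a.1 k)) a]
      refine S.mul_mem (hS _ _) (ih _ fun i hi => ?_)
      change ((incl G k (a.1 k)).1 i)⁻¹ * a.1 i = 1
      by_cases hik : i = k
      · subst hik
        rw [incl_apply_same, inv_mul_cancel]
      · rw [incl_apply_of_ne hik, ha i (by simp [hik, hi]), inv_one, one_mul]
  exact key a.2.toFinset a fun i hi => by
    by_contra h
    exact hi ((Set.Finite.mem_toFinset _).2 h)

theorem deltaHom_mem_Htilde {x : ∀ i, Fin (n i) → G i}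
    (hx : ∀ i, Subgroup.closure (Set.range (x i)) = ⊤) (a : directSum G) :
    deltaHom (directSum G) a ∈ Htilde x := by
  refine mem_of_forall_incl_mem ((Htilde x).comap (deltaHom (directSum G))) (fun i b => ?_) a
  have h : Subgroup.closure (Set.range (x i)) ≤
      ((Htilde x).comap (deltaHom (directSum G))).comap (incl G i) := by
    rw [Subgroup.closure_le]
    rintro _ ⟨j, rfl⟩
    have hs : elemS G ∈ Htilde x := Subgroup.subset_closure (by simp)
    have hF : elemF x ∈ Htilde x := Subgroup.subset_closure (by simp)
    change deltaHom (directSum G) (incl G i (x i j)) ∈ Htilde x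
    rw [← PsiGen_eq_deltaHom, PsiGen, commutatorElement_def]
    have hc := mul_mem (mul_mem (pow_mem hs (2 ^ genIndex n i j - 1)) hF)
      (inv_mem (pow_mem hs (2 ^ genIndex n i j - 1)))
    exact mul_mem (mul_mem (mul_mem hF hc) (inv_mem hF)) (inv_mem hc)
  rw [hx i] at h
  exact h (Subgroup.mem_top b)

/-- The embedding of the direct sum into `H̃`. -/
noncomputable def Psi {x : ∀ i, Fin (n i) → G i}
    (hx : ∀ i, Subgroup.closure (Set.range (x i)) = ⊤) :
    directSum G →* Htilde x :=
  (deltaHom (directSum G)).codRestrict (Htilde x) (deltaHom_mem_Htilde hx)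

theorem Psi_injective {x : ∀ i, Fin (n i) → G i}
    (hx : ∀ i, Subgroup.closure (Set.range (x i)) = ⊤) : Function.Injective (Psi hx) :=
  fun _ _ h => deltaHom_injective (congrArg Subtype.val h)

/-- The word `s ^ k F ^ (±1) s ^ (-k)`. -/
def conjWord (k : ℕ) (e : Bool) : List (Fin 2 × Bool) :=
  (List.range k).map (fun _ => (0, true)) ++ ((1, e) :: (List.range k).map fun _ => (0, false))

/-- The word `[F, s ^ k F s ^ (-k)]`. -/
def commWord (k : ℕ) : List (Fin 2 × Bool) :=
  (1, true) :: (conjWord k true ++ ((1, false) :: conjWord k false))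

theorem primrec_conjWord (e : Bool) : Primrec fun k => conjWord k e :=
  Primrec.list_append.comp (Primrec.list_map Primrec.list_range (Primrec₂.const _))
    (Primrec.list_cons.comp (Primrec.const _)
      (Primrec.list_map Primrec.list_range (Primrec₂.const _)))

theorem primrec_commWord : Primrec commWord :=
  Primrec.list_cons.comp (Primrec.const _) (Primrec.list_append.comp (primrec_conjWord true)
    (Primrec.list_cons.comp (Primrec.const _) (primrec_conjWord false)))

section CommWord

open scoped commutatorElement

theorem wordEval_conjWord {H : Type w} [Group H] (z : Fin 2 → H) (k : ℕ) (e : Bool) :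
    wordEval z (conjWord k e) = z 0 ^ k * cond e (z 1) (z 1)⁻¹ * (z 0 ^ k)⁻¹ := by
  simp [conjWord, wordEval, mul_assoc]

theorem wordEval_commWord {H : Type w} [Group H] (z : Fin 2 → H) (k : ℕ) :
    wordEval z (commWord k) = ⁅z 1, z 0 ^ k * z 1 * (z 0 ^ k)⁻¹⁆ := by
  rw [commWord, wordEval_cons, wordEval_append, wordEval_cons, wordEval_conjWord,
    wordEval_conjWord, commutatorElement_def]
  simp [mul_assoc]

end CommWord

theorem wordEval_commWord_genIndex {x : ∀ i, Fin (n i) → G i}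
    (hx : ∀ i, Subgroup.closure (Set.range (x i)) = ⊤) (i : ℕ) (j : Fin (n i)) :
    wordEval (HtildeGen x) (commWord (2 ^ (numGens n i + j + 1) - 1)) =
      Psi hx (incl G i (x i j)) := by
  apply Subtype.ext
  rw [coe_wordEval_HtildeGen, wordEval_commWord]
  exact PsiGen_eq_deltaHom x i j

theorem computable_commWord_genIndex (hn : Computable n) :
    Computable₂ fun i j : ℕ => commWord (2 ^ (numGens n i + j + 1) - 1) := by
  have h1 : Primrec fun q : ℕ × ℕ => q.1 + q.2 + 1 :=
    Primrec.succ.comp (Primrec.nat_add.comp Primrec.fst Primrec.snd)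
  have h2 : Primrec fun q : ℕ × ℕ => commWord (2 ^ (q.1 + q.2 + 1) - 1) :=
    primrec_commWord.comp (Primrec.nat_sub.comp (primrec_two_pow.comp h1) (Primrec.const 1))
  exact Computable.comp (g := fun q : ℕ × ℕ => (numGens n q.1, q.2)) h2.to_comp
    (Computable.pair ((computable_numGens hn).comp Computable.fst) Computable.snd)

theorem hasDecidableWordProblem_Htilde (hn : Computable n) {x : ∀ i, Fin (n i) → G i}
    (h1 : ComputablePred fun a : ℕ × List (ℕ × Bool) => wordEval (extGen (x a.1)) a.2 = 1) :
    HasDecidableWordProblem (HtildeGen x) :=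
  (IsSparse.computablePred_eq_one (computablePred_sumGen_eq_one hn h1)
    (isSparse_bigFun x)).of_eq fun w => by rw [← coe_wordEval_HtildeGen, OneMemClass.coe_eq_one]

/-- An element lies in the image of the `i`-th group if and only if it lies in the image of the
direct sum and the components with number different from `i` of its preimage are trivial. -/
theorem mem_range_Psi_comp_incl_iff {x : ∀ i, Fin (n i) → G i}
    (hx : ∀ i, Subgroup.closure (Set.range (x i)) = ⊤) (i : ℕ) (h : Htilde x) :
    h ∈ ((Psi hx).comp (incl G i)).range ↔
      (IsDelta h.1 (Multiplicative.ofAdd 1) ∧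
        IsDelta (h.1.left (Multiplicative.ofAdd 1)) 1) ∧
      ∀ i', i' ≠ i → ((h.1.left (Multiplicative.ofAdd 1)).left 1).1 i' = 1 := by
  constructor
  · rintro ⟨a, rfl⟩
    change (IsDelta (deltaHom (directSum G) (incl G i a)) _ ∧ _) ∧ ∀ i', i' ≠ i →
      (((deltaHom (directSum G) (incl G i a)).left _).left 1).1 i' = 1
    refine ⟨isDelta_deltaHom _, fun i' hi' => ?_⟩
    rw [deltaHom_left_left, incl_apply_of_ne hi']
  · rintro ⟨h1, h2⟩
    refine ⟨((h.1.left (Multiplicative.ofAdd 1)).left 1).1 i, Subtype.ext ?_⟩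
    rw [eq_deltaHom h1]
    change deltaHom (directSum G) _ = deltaHom (directSum G) _
    rw [deltaHom_left_left]
    congr 1
    refine Subtype.ext (funext fun i' => ?_)
    by_cases hi : i' = i
    · subst hi
      exact incl_apply_same _ _
    · rw [h2 i' hi, incl_apply_of_ne hi]

theorem hasDecidableMembership_Htilde (hn : Computable n) {x : ∀ i, Fin (n i) → G i}
    (hx : ∀ i, Subgroup.closure (Set.range (x i)) = ⊤)
    (h1 : ComputablePred fun a : ℕ × List (ℕ × Bool) => wordEval (extGen (x a.1)) a.2 = 1)
    (i : ℕ) : HasDecidableMembership (HtildeGen x) ((Psi hx).comp (incl G i)).range := by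
  have hF := isSparse_bigFun x
  have hword : Primrec fun w => stepWord (sparseWord w (Nat.pair 1 0)) 0 :=
    primrec_stepWord.comp (primrec_sparseWord.comp Primrec.id (Primrec.const (Nat.pair 1 0)))
      (Primrec.const 0)
  have hne : ComputablePred fun i' : ℕ => i' ≠ i :=
    (PrimrecPred.computablePred (p := fun i' : ℕ => i' = i)
      (Primrec.eq.comp Primrec.id (Primrec.const i))).not
  refine ((hF.computablePred_isDelta (computablePred_sumGen_eq_one hn h1)).and
    ((computablePred_components_eq_one hn h1 hne).comp hword.to_comp)).of_eq fun w => ?_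
  rw [mem_range_Psi_comp_incl_iff, coe_wordEval_HtildeGen, wordEval_stepWord,
    hF.wordEval_sparseWord, enumPos_pair_one_zero, enumPos_zero]

/-- If the cones of the groups `G i` are decidable by one algorithm, then the iterated lexicographic
cone of the double wreath product is decidable on words in the generators of `H̃`. -/
theorem exists_isComputableLeftOrder_Htilde (hn : Computable n) {x : ∀ i, Fin (n i) → G i}
    {Q : ∀ i, G i → Prop} (hQ : ∀ i, IsPosCone (Q i))
    (h1 : ComputablePred fun a : ℕ × List (ℕ × Bool) => wordEval (extGen (x a.1)) a.2 = 1)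
    (hp : ComputablePred fun a : ℕ × List (ℕ × Bool) => Q a.1 (wordEval (extGen (x a.1)) a.2)) :
    ∃ r : Htilde x → Htilde x → Prop, IsComputableLeftOrder (HtildeGen x) r := by
  have hcone := (isPosCone_wreathCone (isPosCone_wreathCone (isPosCone_sumCone hQ))).comap
    (Htilde x).subtype (Htilde x).subtype_injective
  have hdec : ComputablePred fun w => wreathCone (wreathCone (sumCone Q))
      ((Htilde x).subtype (wordEval (HtildeGen x) w)) :=
    (IsSparse.computablePred_wreathCone (computablePred_sumGen_eq_one hn h1)
      (isPosCone_sumCone hQ) (computablePred_sumCone hn hQ h1 hp)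
      (isSparse_bigFun x)).of_eq fun w => by rw [← coe_wordEval_HtildeGen, Subgroup.coe_subtype]
  refine ⟨_, hcone.isLeftOrder, hdec.of_eq fun w => ?_,
    (hdec.comp primrec_invRev.to_comp).of_eq fun w => ?_, hasDecidableWordProblem_Htilde hn h1⟩
  · rw [inv_one, one_mul]
  · rw [wordEval_invRev, mul_one]

end Htilde

end WreathFamily

theorem propositionP {G : ℕ → Type u} [∀ i, Group (G i)] (n : ℕ → ℕ)
    (x : ∀ i, Fin (n i) → G i)
    (hx : ∀ i, Subgroup.closure (Set.range (x i)) = ⊤) :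
    ∃ Ψ : directSum G →* Htilde x,
      -- `Ψ` is the embedding that extends the prescribed map on the generators
      Function.Injective Ψ ∧
      (∀ i j, (Ψ (incl G i (x i j)) : Wreath (Wreath (directSum G))) = PsiGen x i j) ∧
      -- (1): the induced embeddings are computable, by one algorithm for all `i`
      (IsRecEnumFamily x →
        (∀ i, IsComputableMap (x i) (HtildeGen x) (Ψ.comp (incl G i))) ∧
        ∃ f : ℕ → ℕ → List (Fin 2 × Bool), Computable₂ f ∧
          ∀ i (j : Fin (n i)), wordEval (HtildeGen x) (f i j) = Ψ (incl G i (x i j))) ∧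
      -- (2)
      (IsRecEnumFamilyWithWordProblem x →
        HasDecidableWordProblem (HtildeGen x) ∧
        ∀ i, HasDecidableMembership (HtildeGen x) (Ψ.comp (incl G i)).range) ∧
      -- (3)
      (IsRecEnumFamilyWithLeftOrder x →
        ∃ r : Htilde x → Htilde x → Prop, IsComputableLeftOrder (HtildeGen x) r) := by
  refine ⟨Psi hx, Psi_injective hx, fun i j => (PsiGen_eq_deltaHom x i j).symm, ?_, ?_, ?_⟩
  · rintro ⟨ξ, hξ, hP⟩
    have hf := computable_commWord_genIndex (computable_generators hξ hP)
    exact ⟨fun i => ⟨_, hf.comp (Computable.const i) Primrec.fin_val.to_comp,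
      wordEval_commWord_genIndex hx i⟩, _, hf, wordEval_commWord_genIndex hx⟩
  · rintro ⟨ξ, hξ, hPW⟩
    have hn := computable_generators hξ fun i => (hPW i).1
    have h1 := computablePred_of_solvesWordProblem hξ hn fun i => (hPW i).2
    exact ⟨hasDecidableWordProblem_Htilde hn h1, hasDecidableMembership_Htilde hn hx h1⟩
  · rintro ⟨ξ, hξ, hPr⟩
    choose hP r hr hC using hPr
    have hn := computable_generators hξ hP
    have hr' := fun i => (hr i).isLeftOrder
    have hp := computablePred_extGen_pos hξ hn hP hC hr'
    exact exists_isComputableLeftOrder_Htilde hn (fun i => (hr' i).isPosCone)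
      (computablePred_extGen_eq_one_of_pos hr' hp) hp
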